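/- A project has two stages. Time is continuous, there is a deadline $T>0$, and the number of completed stages is $x_t=\min\{N_t,2\}$, where $N$ is a Poisson process of rate $\lambda>0$ with $N_0=0$; let $\tau_2=\inf\{t: x_t=2\}$. The principal pays a flow cost $c>0$ until the investment is stopped. If the project is completed when the investment is stopped, a profit $v>0$ is paid at that date, of which the principal gets the share $\alpha\in(0,1]$ and the agent the share $1-\alpha$. The agent also gets a flow benefit $\beta c$, $\beta\ge 0$, until stopping. Payoffs are discounted at a rate $r>0$. Assume that it is not the case that both $\alpha=1$ and $\beta=0$. Let $\kappa=c/(v\lambda)$. An investment schedule is a stopping time $\tau$ with values in $[0,T]$ with respect to a filtration $(\mathcal F_t)$ to which $x$ is adapted and such that $N_t-N_s$ is independent of $\mathcal F_s$ for all $s\le t$ (the natural filtration of $x$, possibly enlarged by external randomization). The expected payoffs of the agent and the principal from $\tau$ are $$W(\tau)=\mathbb E\Big[(1-\alpha)v\,e^{-r\tau}\mathbf 1_{\{x_\tau=2\}}+\beta c\int_0^{\tau}e^{-rs}ds\Big],\qquad V(\tau)=\mathbb E\Big[\alpha v\,e^{-r\tau}\mathbf 1_{\{x_\tau=2\}}-c\int_0^{\tau}e^{-rs}ds\Big],$$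 and the principal's continuation value at date $t$ is $$V_t(\tau)=\mathbb E\Big[\alpha v\big(e^{-r(\tau-t)}\mathbf 1_{\{x_\tau=2\}}-\mathbf 1_{\{x_t=2\}}\big)-c\int_t^{\tau}e^{-r(s-t)}ds\;\Big|\;t<\tau\Big].$$ An investment schedule is optimal if it maximizes $W(\tau)$ over the investment schedules with $V_t(\tau)\ge 0$ for all $t\ge 0$ with $\mathbb P(t<\tau)>0$. There are cutoffs $0<\tilde\kappa(T,\lambda,r,\alpha)<\kappa^{FI}(T,\lambda,r,\alpha)$, which depend only on the parameters shown, such that $\kappa<\kappa^{FI}$ if and only if the full-information benchmark is profitable for the principal, i.e. $V(\sigma)>0$ for some investment schedule $\sigma$, and the following hold. (a) If $\kappa\le\tilde\kappa(T,\lambda,r,\alpha)$, then an optimal investment schedule exists, and every optimal investment schedule satisfies $\tau\ge\tau_2\wedge T$ almost surely: before the deadline the principal is told to stop only after the completion of the second stage. (b) If $\tilde\kappa(T,\lambda,r,\alpha)<\kappa<\kappa^{FI}(T,\lambda,r,\alpha)$, then an optimal investment schedule exists, and every optimal investment schedule stops with positive probability before $T$ in state $2$, and with positive probability at a date strictly between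 $0$ and $T$ in state $0$: $\mathbb P(\tau<T,\,x_\tau=2)>0$ and $\mathbb P(0<\tau<T,\,x_\tau=0)>0$ (an interim deadline). -/

import Mathlib

open MeasureTheory ProbabilityTheory
open scoped NNReal ENNReal

/-- The data of a two-stage project with a public deadline: deadline `T`, Poisson rate `lam`
at which a stage is completed, discount rate `r`, the principal's share `α` of the completion
profit `v` (the agent gets `1 - α`), the principal's flow cost `c`, and the agent's flow
benefit `β * c`. -/
structure Project where
  T : ℝ≥0
  lam : ℝ≥0
  r : ℝ
  α : ℝ
  β : ℝ
  v : ℝ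
  c : ℝ
  T_pos : 0 < T
  lam_pos : 0 < lam
  r_pos : 0 < r
  α_pos : 0 < α
  α_le_one : α ≤ 1
  β_nonneg : 0 ≤ β
  v_pos : 0 < v
  c_pos : 0 < c

namespace Project

/-- The flow cost-benefit ratio `κ = c / (v λ)`. -/
noncomputable def κ (P : Project) : ℝ := P.c / (P.v * P.lam)

/-- Present value `∫₀ᵗ e^{-rs} ds = (1 - e^{-rt}) / r` of a unit flow up to date `t`. -/
noncomputable def annuity (P : Project) (t : ℝ) : ℝ := (1 - Real.exp (-P.r * t)) / P.r

variable {Ω : Type*}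

/-- The number of completed stages `x_t ∈ {0, 1, 2}`, for a counting process `N`. -/
def stage (N : ℝ≥0 → Ω → ℕ) (t : ℝ≥0) (ω : Ω) : ℕ := min (N t ω) 2

/-- `τ₂`, the date of completion of the second stage (`⊤` if it is never completed). -/
noncomputable def completion (N : ℝ≥0 → Ω → ℕ) : Ω → WithTop ℝ≥0 :=
  hittingAfter (stage N) {2} 0

/-- The indicator of the event that the project is completed by date `t`. -/
noncomputable def completed (N : ℝ≥0 → Ω → ℕ) (t : ℝ≥0) (ω : Ω) : ℝ :=
  if stage N t ω = 2 then 1 else 0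

/-- `N` is a Poisson process of rate `lam` whose increments after each date `s` are independent
of the information `ℱ s`, and the number of completed stages is observed in `ℱ`. The filtration
generated by the number of completed stages is one such `ℱ` (stopping rules without external
randomization); a larger `ℱ` allows for external, possibly private, randomization. -/
structure IsPoissonFor {m : MeasurableSpace Ω} (lam : ℝ≥0) (μ : Measure Ω)
    (ℱ : Filtration ℝ≥0 m) (N : ℝ≥0 → Ω → ℕ) : Prop where
  zero : ∀ ω, N 0 ω = 0
  mono : ∀ ω, Monotone fun t => N t ω
  rightCont : ∀ ω t, ContinuousWithinAt (fun s => N s ω) (Set.Ici t) t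
  measurable : ∀ t, Measurable (N t)
  adapted : Adapted ℱ (stage N)
  indep : ∀ s t, s ≤ t →
    Indep (MeasurableSpace.comap (fun ω => N t ω - N s ω) ⊤) (ℱ s) μ
  law : ∀ s t, s ≤ t →
    μ.map (fun ω => N t ω - N s ω) = poissonMeasure (lam * (t - s))

/-- An investment schedule: a stopping time with values in `[0, T]`. -/
structure IsSchedule (P : Project) {m : MeasurableSpace Ω} (ℱ : Filtration ℝ≥0 m)
    (τ : Ω → ℝ≥0) : Prop where
  stopping : IsStoppingTime ℱ fun ω => (τ ω : WithTop ℝ≥0)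
  le_deadline : ∀ ω, τ ω ≤ P.T

/-- The principal's expected discounted payoff `V(τ)`. -/
noncomputable def principalPayoff (P : Project) {m : MeasurableSpace Ω} (μ : Measure Ω)
    (N : ℝ≥0 → Ω → ℕ) (τ : Ω → ℝ≥0) : ℝ :=
  ∫ ω, (P.α * P.v * (Real.exp (-P.r * τ ω) * completed N (τ ω) ω)
    - P.c * P.annuity (τ ω)) ∂μ

/-- The agent's expected discounted payoff `W(τ)`. -/
noncomputable def agentPayoff (P : Project) {m : MeasurableSpace Ω} (μ : Measure Ω)
    (N : ℝ≥0 → Ω → ℕ) (τ : Ω → ℝ≥0) : ℝ :=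
  ∫ ω, ((1 - P.α) * P.v * (Real.exp (-P.r * τ ω) * completed N (τ ω) ω)
    + P.β * P.c * P.annuity (τ ω)) ∂μ

/-- The principal's continuation value `V_t(τ)`: conditionally on `t < τ`, the expected payoff,
discounted to date `t`, of following `τ`, minus the expected payoff of stopping at `t`.
It is `0` if `t < τ` has probability zero. -/
noncomputable def continuationValue (P : Project) {m : MeasurableSpace Ω} (μ : Measure Ω)
    (N : ℝ≥0 → Ω → ℕ) (τ : Ω → ℝ≥0) (t : ℝ≥0) : ℝ :=
  ∫ ω, (P.α * P.v * (Real.exp (-P.r * ((τ ω : ℝ) - t)) * completed N (τ ω) ω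
      - completed N t ω)
    - P.c * P.annuity ((τ ω : ℝ) - t)) ∂(cond μ {ω | t < τ ω})

/-- A schedule that satisfies all of the principal's individual rationality constraints. -/
structure IsFeasible (P : Project) {m : MeasurableSpace Ω} (μ : Measure Ω)
    (ℱ : Filtration ℝ≥0 m) (N : ℝ≥0 → Ω → ℕ) (τ : Ω → ℝ≥0) : Prop where
  schedule : P.IsSchedule ℱ τ
  rational : ∀ t, 0 ≤ P.continuationValue μ N τ t

/-- An optimal schedule: it maximizes the agent's payoff over the feasible schedules. -/
structure IsOptimal (P : Project) {m : MeasurableSpace Ω} (μ : Measure Ω)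
    (ℱ : Filtration ℝ≥0 m) (N : ℝ≥0 → Ω → ℕ) (τ : Ω → ℝ≥0) : Prop where
  feasible : P.IsFeasible μ ℱ N τ
  maximal : ∀ σ, P.IsFeasible μ ℱ N σ → P.agentPayoff μ N σ ≤ P.agentPayoff μ N τ

/-- The full-information benchmark is profitable: a principal who observes the progress of the
project and stops when he likes can obtain a positive expected payoff. -/
def FullInfoProfitable (P : Project) {m : MeasurableSpace Ω} (μ : Measure Ω)
    (ℱ : Filtration ℝ≥0 m) (N : ℝ≥0 → Ω → ℕ) : Prop :=
  ∃ σ, P.IsSchedule ℱ σ ∧ 0 < P.principalPayoff μ N σ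

end Project

/-! By Dynkin's formula for the stage process, any combination of discounted completion and
discounted duration is the discounted integral of a flow that depends only on the stage
(`integral_payoff`). For the principal the flow is `-c` in stage 0, `gain` in stage 1 and
`-delayCost` in stage 2. The conditional rationality constraints become nonnegativity of the tail
integrals of the principal's expected flow (`isFeasible_iff`). The problem is thus linear in the
occupation probabilities `occ`, which are bounded by the unstopped probabilities `prob`.

A second use of Dynkin's formula charges the stage-1 flow to stage 0 (`integral_flow`): stage 0 at
date `u` is worth `weight g₀ g₁ u`, which decreases in `u` if `g₁ > 0`. What remains is the stage-2
flow and a penalty `g₁ * forgone` for stopping in stage 1. Hence some schedule is profitable iff the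
principal's weight at date 0 is positive, which gives the full-information cutoff. The lower cutoff
is where stopping only at completion or the deadline just breaks even.

Low cost: if the agent dislikes delay after completion, stopping at completion is best flow by flow.
Otherwise completed projects are kept running until a date `S` at which the slack of the principal
is used up, so that the constraint binds at some `t ≤ S`. Before `t` this schedule maximizes each
flow of the agent; after `t` it maximizes the Lagrangian whose multiplier cancels the stage-2 flow.
The comparison leaves a margin proportional to the lost time in stage 1
(`exists_feasible_dominating`). An optimal schedule therefore loses none, and then it loses no
stage-0 time either.

Intermediate cost: running stage 0 up to the deadline loses money, so there is an interim deadline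
`S < T` at which the principal breaks even. A multiplier on the date-0 constraint makes the
Lagrangian weight vanish exactly at `S`; the stage-2 flow is then negative and the stage-1 flow
positive. The interim-deadline schedule beats any feasible one by at least a sum of four nonnegative
terms (`lagrangianGap`). For an optimal schedule all four vanish, which fixes its behaviour on the
events `x_S = 0` and `x_S = 2`, both of positive probability. -/

namespace Project

/-! ### Paths of the stage process and its forward equation -/

section CountingPaths

variable {Ω : Type*} {m : MeasurableSpace Ω} {μ : Measure Ω} {ℱ : Filtration ℝ≥0 m}
  {N : ℝ≥0 → Ω → ℕ} {lam : ℝ≥0}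

lemma stage_mono (hN : IsPoissonFor lam μ ℱ N) (ω : Ω) : Monotone fun t => stage N t ω :=
  fun _ _ h => min_le_min_right 2 (hN.mono ω h)

lemma stage_le_two (t : ℝ≥0) (ω : Ω) : stage N t ω ≤ 2 := min_le_right _ _

lemma stage_eventually_eq (hN : IsPoissonFor lam μ ℱ N) (ω : Ω) (t : ℝ≥0) :
    ∀ᶠ s in nhdsWithin t (Set.Ici t), stage N s ω = stage N t ω := by
  have h := hN.rightCont ω t
  rw [ContinuousWithinAt, nhds_discrete, Filter.tendsto_pure] at h
  filter_upwards [h] with s hs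
  simp only [stage, hs]

lemma exists_stage_eq_of_lt (hN : IsPoissonFor lam μ ℱ N) (ω : Ω) (t : ℝ≥0) :
    ∃ u, t < u ∧ ∀ s, t ≤ s → s < u → stage N s ω = stage N t ω := by
  have h := stage_eventually_eq hN ω t
  rw [Filter.Eventually, mem_nhdsGE_iff_exists_Ico_subset] at h
  obtain ⟨u, hu, hs⟩ := h
  exact ⟨u, hu, fun s h1 h2 => hs ⟨h1, h2⟩⟩

lemma measurable_stage (hN : IsPoissonFor lam μ ℱ N) (t : ℝ≥0) : Measurable (stage N t) :=
  (hN.measurable t).min measurable_const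

/-- Right-continuous monotone counting paths are jointly measurable. -/
lemma measurable_stage_uncurry (hN : IsPoissonFor lam μ ℱ N) :
    Measurable (fun p : ℝ≥0 × Ω => stage N p.1 p.2) := by
  have key : ∀ k, MeasurableSet {p : ℝ≥0 × Ω | stage N p.1 p.2 < k} := by
    intro k
    obtain ⟨D, hDc, hD⟩ := TopologicalSpace.exists_countable_dense ℝ≥0
    -- Right-continuity supplies a date of `D` after `t` with the same stage; monotonicity gives the
    -- converse inclusion.
    have : {p : ℝ≥0 × Ω | stage N p.1 p.2 < k} =
        ⋃ q ∈ D, Set.Iio q ×ˢ {ω | stage N q ω < k} := by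
      ext ⟨t, ω⟩
      simp only [Set.mem_ofPred_eq, Set.mem_iUnion, Set.mem_prod, Set.mem_Iio, exists_prop]
      constructor
      · intro h
        obtain ⟨u, hu, hs⟩ := exists_stage_eq_of_lt hN ω t
        obtain ⟨q, hq, h1, h2⟩ := hD.exists_between hu
        exact ⟨q, hq, h1, by rw [hs q h1.le h2]; exact h⟩
      · rintro ⟨q, _, h1, h2⟩
        exact (stage_mono hN ω h1.le).trans_lt h2
    rw [this]
    refine MeasurableSet.biUnion hDc fun q _ => measurableSet_Iio.prod ?_
    exact measurableSet_lt (measurable_stage hN q) measurable_const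
  exact measurable_of_Iio key

lemma measurable_schedule {P : Project} {σ : Ω → ℝ≥0} (hσ : P.IsSchedule ℱ σ) :
    Measurable σ := by
  refine measurable_of_Iic fun t => ?_
  have h := ℱ.le t _ (hσ.stopping t)
  have : {ω | (σ ω : WithTop ℝ≥0) ≤ t} = σ ⁻¹' Set.Iic t := by
    ext ω
    exact WithTop.coe_le_coe
  rwa [← this]

lemma measurable_stage_at (hN : IsPoissonFor lam μ ℱ N) {σ : Ω → ℝ≥0} (hσ : Measurable σ) :
    Measurable fun ω => stage N (σ ω) ω :=
  (measurable_stage_uncurry hN).comp (hσ.prodMk measurable_id)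

lemma measurableSet_stage_eq (hN : IsPoissonFor lam μ ℱ N) (s : ℝ≥0) (i : ℕ) :
    MeasurableSet[ℱ s] {ω | stage N s ω = i} :=
  (hN.adapted s) (measurableSet_singleton i)

/-- Independence and law of an increment, given an event known at its start. -/
lemma measureReal_inter_increment (hN : IsPoissonFor lam μ ℱ N) {s t : ℝ≥0} (hst : s ≤ t)
    {A : Set Ω} (hA : MeasurableSet[ℱ s] A) (k : ℕ) :
    μ.real (A ∩ {ω | N t ω - N s ω = k}) =
      μ.real A * (Real.exp (-(lam * (t - s) : ℝ)) * (lam * (t - s) : ℝ) ^ k / k.factorial) := by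
  have hind := (Indep_iff _ _ μ).1 (hN.indep s t hst) {ω | N t ω - N s ω = k} A
    ⟨{k}, trivial, rfl⟩ hA
  have hlaw : μ.real {ω | N t ω - N s ω = k} = (poissonMeasure (lam * (t - s))).real {k} := by
    have hm : Measurable fun ω => N t ω - N s ω := (hN.measurable t).sub (hN.measurable s)
    rw [← hN.law s t hst, map_measureReal_apply hm (measurableSet_singleton k)]
    rfl
  rw [Set.inter_comm, measureReal_def, hind, ENNReal.toReal_mul, mul_comm, ← measureReal_def,
    ← measureReal_def, hlaw, poissonMeasure_real_singleton]
  simp [NNReal.coe_sub hst]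

lemma measureReal_inter_stage_zero (hN : IsPoissonFor lam μ ℱ N) {s t : ℝ≥0} (hst : s ≤ t)
    {A : Set Ω} (hA : MeasurableSet[ℱ s] A) :
    μ.real (A ∩ {ω | stage N t ω = 0}) =
      μ.real (A ∩ {ω | stage N s ω = 0}) * Real.exp (-(lam * (t - s) : ℝ)) := by
  have h := measureReal_inter_increment hN hst (hA.inter (measurableSet_stage_eq hN s 0)) 0
  simp only [pow_zero, Nat.factorial_zero, Nat.cast_one, div_one, mul_one] at h
  rw [← h]
  congr 1
  ext ω
  have := hN.mono ω hst
  simp only [Set.mem_inter_iff, Set.mem_ofPred_eq, stage] at this ⊢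
  constructor
  · rintro ⟨a, b⟩; exact ⟨⟨a, by omega⟩, by omega⟩
  · rintro ⟨⟨a, b⟩, c⟩; exact ⟨a, by omega⟩

/-- Stage 1 at `t` arises from stage 1 at `s` with no increment or from stage 0 with a single one.
Both starting events are known at `s`, so independence of the increment applies. -/
lemma measureReal_inter_stage_one [IsFiniteMeasure μ] (hN : IsPoissonFor lam μ ℱ N) {s t : ℝ≥0}
    (hst : s ≤ t) {A : Set Ω} (hA : MeasurableSet[ℱ s] A) :
    μ.real (A ∩ {ω | stage N t ω = 1}) =
      (μ.real (A ∩ {ω | stage N s ω = 1}) + μ.real (A ∩ {ω | stage N s ω = 0}) *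
        (lam * (t - s))) * Real.exp (-(lam * (t - s) : ℝ)) := by
  have h1 := measureReal_inter_increment hN hst (hA.inter (measurableSet_stage_eq hN s 1)) 0
  have h0 := measureReal_inter_increment hN hst (hA.inter (measurableSet_stage_eq hN s 0)) 1
  simp only [pow_zero, pow_one, Nat.factorial_zero, Nat.factorial_one, Nat.cast_one, div_one,
    mul_one] at h0 h1
  have : A ∩ {ω | stage N t ω = 1} =
      (A ∩ {ω | stage N s ω = 1} ∩ {ω | N t ω - N s ω = 0}) ∪
      (A ∩ {ω | stage N s ω = 0} ∩ {ω | N t ω - N s ω = 1}) := by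
    ext ω
    have := hN.mono ω hst
    simp only [Set.mem_inter_iff, Set.mem_ofPred_eq, Set.mem_union, stage] at this ⊢
    constructor
    · rintro ⟨a, b⟩
      by_cases h : N s ω = 0
      · exact Or.inr ⟨⟨a, by omega⟩, by omega⟩
      · exact Or.inl ⟨⟨a, by omega⟩, by omega⟩
    · rintro (⟨⟨a, b⟩, c⟩ | ⟨⟨a, b⟩, c⟩) <;> exact ⟨a, by omega⟩
  rw [this, measureReal_union, h1, h0]
  · ring
  · refine Set.disjoint_left.2 ?_
    rintro ω ⟨_, h⟩ ⟨_, h'⟩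
    simp only [Set.mem_ofPred_eq] at h h'
    omega
  · refine ((ℱ.le s _ hA).inter (ℱ.le s _ (measurableSet_stage_eq hN s 0))).inter ?_
    exact ((hN.measurable t).sub (hN.measurable s)) (measurableSet_singleton 1)

lemma measureReal_eq_sum_stage [IsFiniteMeasure μ] (hN : IsPoissonFor lam μ ℱ N) (t : ℝ≥0)
    {A : Set Ω} (hA : MeasurableSet A) :
    μ.real A = μ.real (A ∩ {ω | stage N t ω = 0}) + μ.real (A ∩ {ω | stage N t ω = 1}) +
      μ.real (A ∩ {ω | stage N t ω = 2}) := by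
  have hm : ∀ i, MeasurableSet {ω | stage N t ω = i} := fun i =>
    measurable_stage hN t (measurableSet_singleton i)
  rw [← measureReal_union _ (hA.inter (hm 1)), ← measureReal_union _ (hA.inter (hm 2))]
  · congr 1
    ext ω
    have := stage_le_two (N := N) t ω
    simp only [Set.mem_union, Set.mem_inter_iff, Set.mem_ofPred_eq]
    have : stage N t ω = 0 ∨ stage N t ω = 1 ∨ stage N t ω = 2 := by omega
    tauto
  · refine Set.disjoint_left.2 ?_
    rintro ω (⟨_, h⟩ | ⟨_, h⟩) ⟨_, h'⟩ <;> simp only [Set.mem_ofPred_eq] at h h' <;> omega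
  · refine Set.disjoint_left.2 ?_
    rintro ω ⟨_, h⟩ ⟨_, h'⟩
    simp only [Set.mem_ofPred_eq] at h h'
    omega

/-- The forward equation of the number of completed stages: net inflow into stage `i`, per unit
of the completion rate, if `a` is the distribution over the stages. -/
def inflow (a : ℕ → ℝ) : ℕ → ℝ
  | 0 => -a 0
  | 1 => a 0 - a 1
  | _ => a 1

/-- Forward equation in integrated form, on an event `A` known at the start `s`, for the weighted
probabilities of the stages. -/
lemma integral_forward [IsFiniteMeasure μ] (hN : IsPoissonFor lam μ ℱ N) {s t : ℝ} (hs : 0 ≤ s)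
    (hst : s ≤ t) {A : Set Ω} (hA : MeasurableSet[ℱ s.toNNReal] A) {φ φ' : ℝ → ℝ}
    (hφ : ∀ u, HasDerivAt φ (φ' u) u) (hφ' : Continuous φ') {i : ℕ} (hi : i ≤ 2) :
    φ t * μ.real (A ∩ {ω | stage N t.toNNReal ω = i}) -
      φ s * μ.real (A ∩ {ω | stage N s.toNNReal ω = i}) =
    ∫ u in s..t, (φ' u * μ.real (A ∩ {ω | stage N u.toNNReal ω = i}) +
      lam * φ u * inflow (fun j => μ.real (A ∩ {ω | stage N u.toNNReal ω = j})) i) := by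
  set a : ℕ → ℝ → ℝ := fun j u => μ.real (A ∩ {ω | stage N u.toNNReal ω = j}) with ha
  -- The explicit solution of the forward equation started at `s`. It is smooth on the whole line,
  -- whereas `a` agrees with it only after `s`, so the fundamental theorem is applied to `b`.
  let b : ℕ → ℝ → ℝ := fun j u => match j with
    | 0 => a 0 s * Real.exp (-(lam * (u - s)))
    | 1 => (a 1 s + a 0 s * (lam * (u - s))) * Real.exp (-(lam * (u - s)))
    | _ => a 0 s + a 1 s + a 2 s - (a 1 s + a 0 s * (lam * (u - s)) + a 0 s) *
        Real.exp (-(lam * (u - s)))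
  have hab : ∀ j ≤ 2, ∀ u, s ≤ u → a j u = b j u := by
    intro j hj u hu
    have hu' : s.toNNReal ≤ u.toNNReal := Real.toNNReal_le_toNNReal hu
    have h0 := measureReal_inter_stage_zero hN hu' hA
    have h1 := measureReal_inter_stage_one hN hu' hA
    have h2 := measureReal_eq_sum_stage hN u.toNNReal (ℱ.le _ _ hA)
    have h3 := measureReal_eq_sum_stage hN s.toNNReal (ℱ.le _ _ hA)
    rw [Real.coe_toNNReal s hs, Real.coe_toNNReal u (hs.trans hu)] at h0 h1
    interval_cases j
    · exact h0
    · exact h1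
    · simp only [ha, b]
      linarith
  have hE : ∀ u, HasDerivAt (fun u : ℝ => Real.exp (-(lam * (u - s))))
      (-(lam * Real.exp (-(lam * (u - s))))) u := by
    intro u
    have : HasDerivAt (fun u : ℝ => -((lam : ℝ) * (u - s))) (-(lam * 1)) u :=
      (((hasDerivAt_id u).sub_const s).const_mul (lam : ℝ)).neg
    convert! this.exp using 1; ring
  have hL : ∀ u, HasDerivAt (fun u : ℝ => a 0 s * ((lam : ℝ) * (u - s))) (a 0 s * lam) u := by
    intro u
    have := (((hasDerivAt_id u).sub_const s).const_mul (lam : ℝ)).const_mul (a 0 s)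
    simpa using! this
  have hb : ∀ u, HasDerivAt (b i) (lam * inflow (fun j => b j u) i) u := by
    intro u
    interval_cases i
    · convert! (hE u).const_mul (a 0 s) using 1
      simp only [inflow, b]; ring
    · convert! ((hL u).const_add (a 1 s)).mul (hE u) using 1
      simp only [inflow, b]; ring
    · convert! ((((hL u).const_add (a 1 s)).add_const (a 0 s)).mul (hE u)).const_sub
        (a 0 s + a 1 s + a 2 s) using 1
      simp only [inflow, b]; ring
  have hbc : ∀ j, Continuous (b j) := by
    intro j
    simp only [b]
    split <;> fun_prop
  have hd : ∀ u, HasDerivAt (fun u => φ u * b i u)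
      (φ' u * b i u + lam * φ u * inflow (fun j => b j u) i) u := by
    intro u
    convert! (hφ u).mul (hb u) using 1; ring
  have hφc : Continuous φ := continuous_iff_continuousAt.2 fun u => (hφ u).continuousAt
  have hci : Continuous fun u => inflow (fun j => b j u) i := by
    interval_cases i
    · exact (hbc 0).neg
    · exact (hbc 0).sub (hbc 1)
    · exact hbc 1
  have hftc := intervalIntegral.integral_eq_sub_of_hasDerivAt (a := s) (b := t)
    (fun u _ => hd u) (Continuous.intervalIntegrable
      ((hφ'.mul (hbc i)).add ((continuous_const.mul hφc).mul hci)) _ _)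
  change φ t * a i t - φ s * a i s = _
  rw [hab i hi t hst, hab i hi s le_rfl, ← hftc]
  refine intervalIntegral.integral_congr fun u hu => ?_
  rw [Set.uIcc_of_le hst] at hu
  have h : ∀ j ≤ 2, μ.real (A ∩ {ω | stage N u.toNNReal ω = j}) = b j u :=
    fun j hj => hab j hj u hu.1
  rw [h i hi]
  congr 2
  interval_cases i
  · simp only [inflow, h 0 (by norm_num)]
  · simp only [inflow, h 0 (by norm_num), h 1 (by norm_num)]
  · simp only [inflow, h 1 (by norm_num)]

end CountingPaths

/-! ### Dynkin's formula by approximation with grid-valued times -/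

section Dynkin

variable {Ω : Type*} {m : MeasurableSpace Ω} {μ : Measure Ω} {ℱ : Filtration ℝ≥0 m}
  {N : ℝ≥0 → Ω → ℕ} {lam : ℝ≥0}

/-- The probability that the project is in stage `i` at date `u` and not stopped by then. -/
noncomputable def occ {m : MeasurableSpace Ω} (μ : Measure Ω) (N : ℝ≥0 → Ω → ℕ) (σ : Ω → ℝ≥0)
    (i : ℕ) (u : ℝ) : ℝ :=
  μ.real {ω | u.toNNReal < σ ω ∧ stage N u.toNNReal ω = i}

lemma measurableSet_stage_path (hN : IsPoissonFor lam μ ℱ N) (i : ℕ) :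
    MeasurableSet {p : ℝ × Ω | stage N p.1.toNNReal p.2 = i} := by
  have : Measurable fun p : ℝ × Ω => stage N p.1.toNNReal p.2 :=
    (measurable_stage_uncurry hN).comp
      ((measurable_real_toNNReal.comp measurable_fst).prodMk measurable_snd)
  exact this (measurableSet_singleton i)

lemma measurable_measureReal_slice [IsFiniteMeasure μ] {Z : Set (ℝ × Ω)} (hZ : MeasurableSet Z) :
    Measurable fun u => μ.real {ω | (u, ω) ∈ Z} :=
  (measurable_measure_prodMk_left hZ).ennreal_toReal

lemma measurable_occ_le [IsFiniteMeasure μ] (hN : IsPoissonFor lam μ ℱ N) {σ : Ω → ℝ≥0}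
    (hσ : Measurable σ) (i : ℕ) :
    Measurable fun u : ℝ => μ.real {ω | u.toNNReal ≤ σ ω ∧ stage N u.toNNReal ω = i} :=
  measurable_measureReal_slice (Z := {p | p.1.toNNReal ≤ σ p.2} ∩
      {p | stage N p.1.toNNReal p.2 = i})
    ((measurableSet_le (measurable_real_toNNReal.comp measurable_fst)
      (hσ.comp measurable_snd)).inter (measurableSet_stage_path hN i))

lemma measurableSet_running (hN : IsPoissonFor lam μ ℱ N) {σ : Ω → ℝ≥0}
    (hσ : Measurable σ) (i : ℕ) :
    MeasurableSet {p : ℝ × Ω | p.1.toNNReal < σ p.2 ∧ stage N p.1.toNNReal p.2 = i} :=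
  (measurableSet_lt (measurable_real_toNNReal.comp measurable_fst)
      (hσ.comp measurable_snd)).inter (measurableSet_stage_path hN i)

lemma measurable_occ [IsFiniteMeasure μ] (hN : IsPoissonFor lam μ ℱ N) {σ : Ω → ℝ≥0}
    (hσ : Measurable σ) (i : ℕ) : Measurable (occ μ N σ i) :=
  measurable_measureReal_slice (measurableSet_running hN hσ i)

/-- A continuous weight times a measurable function bounded by one is integrable. -/
lemma intervalIntegrable_mul_of_le_one {φ f : ℝ → ℝ} (hφ : Continuous φ) (hf : Measurable f)
    (h0 : ∀ u, |f u| ≤ 1) (a b : ℝ) :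
    IntervalIntegrable (fun u => φ u * f u) volume a b := by
  refine (hφ.intervalIntegrable a b).mono_fun (hφ.measurable.mul hf).aestronglyMeasurable
    (Filter.Eventually.of_forall fun u => ?_)
  simp only [Real.norm_eq_abs, abs_mul]
  exact mul_le_of_le_one_right (abs_nonneg _) (h0 u)

lemma abs_measureReal_le_one [IsProbabilityMeasure μ] (A : Set Ω) : |μ.real A| ≤ 1 := by
  rw [abs_of_nonneg measureReal_nonneg]; exact measureReal_le_one

lemma abs_inflow_le {a : ℕ → ℝ} (h0 : ∀ j, 0 ≤ a j) (h1 : ∀ j, a j ≤ 1) (i : ℕ) :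
    |inflow a i| ≤ 1 := by
  rw [abs_le]
  match i with
  | 0 => constructor <;> simp only [inflow] <;> linarith [h0 0, h1 0]
  | 1 => constructor <;> simp only [inflow] <;> linarith [h0 0, h1 0, h0 1, h1 1]
  | (n + 2) => constructor <;> simp only [inflow] <;> linarith [h0 1, h1 1]

lemma measurable_inflow {f : ℕ → ℝ → ℝ} (hf : ∀ j, Measurable (f j)) (i : ℕ) :
    Measurable fun u => inflow (fun j => f j u) i := by
  match i with
  | 0 => exact (hf 0).neg
  | 1 => exact (hf 0).sub (hf 1)
  | (n + 2) => exact hf 1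

lemma tendsto_inflow {ι : Type*} {l : Filter ι} {f : ι → ℕ → ℝ} {g : ℕ → ℝ}
    (h : ∀ j, Filter.Tendsto (fun n => f n j) l (nhds (g j))) (i : ℕ) :
    Filter.Tendsto (fun n => inflow (f n) i) l (nhds (inflow g i)) := by
  match i with
  | 0 => exact (h 0).neg
  | 1 => exact (h 0).sub (h 1)
  | (n + 2) => exact h 1

/-- The smallest grid point of mesh `T / n` not below `σ`. -/
noncomputable def gridCeil (T : ℝ≥0) (n : ℕ) (σ : ℝ≥0) : ℝ≥0 := ⌈σ * n / T⌉₊ * T / n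

lemma le_gridCeil {T : ℝ≥0} (hT : 0 < T) {n : ℕ} (hn : 0 < n) (σ : ℝ≥0) :
    σ ≤ gridCeil T n σ := by
  have hn' : (0 : ℝ≥0) < n := by exact_mod_cast hn
  rw [gridCeil, le_div_iff₀ hn', ← div_le_iff₀ hT]
  exact Nat.le_ceil _

lemma gridCeil_le {T : ℝ≥0} (hT : 0 < T) {n : ℕ} (hn : 0 < n) (σ : ℝ≥0) :
    gridCeil T n σ ≤ σ + T / n := by
  have hn' : (0 : ℝ≥0) < n := by exact_mod_cast hn
  have h : (⌈σ * n / T⌉₊ : ℝ≥0) ≤ σ * n / T + 1 := (Nat.ceil_lt_add_one zero_le).le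
  calc gridCeil T n σ ≤ (σ * n / T + 1) * T / n := by rw [gridCeil]; gcongr
    _ = σ + T / n := by field_simp

lemma tendsto_gridCeil {T : ℝ≥0} (hT : 0 < T) (σ : ℝ≥0) :
    Filter.Tendsto (fun n : ℕ => gridCeil T (n + 1) σ) Filter.atTop (nhds σ) := by
  have hz : Filter.Tendsto (fun n : ℕ => (T : ℝ≥0) / ((n + 1 : ℕ) : ℝ≥0)) Filter.atTop (nhds 0) :=
    NNReal.tendsto_coe.1 (by
      simpa [Function.comp_def] using! (tendsto_const_div_atTop_nhds_zero_nat (T : ℝ)).comp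
        (Filter.tendsto_add_atTop_nat 1))
  refine tendsto_of_tendsto_of_tendsto_of_le_of_le tendsto_const_nhds
    (by simpa using hz.const_add σ) (fun n => le_gridCeil hT n.succ_pos σ)
    (fun n => gridCeil_le hT n.succ_pos σ)

lemma measurable_gridCeil (T : ℝ≥0) (n : ℕ) : Measurable (gridCeil T n) :=
  ((((measurable_from_nat (f := fun k : ℕ => (k : ℝ≥0))).comp (Nat.measurable_ceil.comp
    ((measurable_id.mul_const _).div_const _))).mul_const _).div_const _)

/-- Dynkin's formula for a schedule rounded up to the grid. -/
lemma dynkin_gridCeil [IsProbabilityMeasure μ] {P : Project} (hN : IsPoissonFor lam μ ℱ N)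
    {σ : Ω → ℝ≥0} (hσ : P.IsSchedule ℱ σ) {φ φ' : ℝ → ℝ}
    (hφ : ∀ u, HasDerivAt φ (φ' u) u) (hφ' : Continuous φ') {i : ℕ} (hi : i ≤ 2)
    {n : ℕ} (hn : 0 < n) :
    ∫ ω, (φ (gridCeil P.T n (σ ω)) * (if stage N (gridCeil P.T n (σ ω)) ω = i then 1 else 0)
      - φ 0 * (if stage N 0 ω = i then 1 else 0)) ∂μ =
    ∫ u in (0 : ℝ)..P.T,
      (φ' u * μ.real {ω | u.toNNReal ≤ gridCeil P.T n (σ ω) ∧ stage N u.toNNReal ω = i} +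
      lam * φ u * inflow (fun j => μ.real {ω | u.toNNReal ≤ gridCeil P.T n (σ ω) ∧
        stage N u.toNNReal ω = j}) i) := by
  have hT := P.T_pos
  have hn' : (0 : ℝ≥0) < n := by exact_mod_cast hn
  have hφc : Continuous φ := continuous_iff_continuousAt.2 fun u => (hφ u).continuousAt
  set t : ℕ → ℝ := fun k => k * P.T / n with ht
  have ht0 : ∀ k, 0 ≤ t k := fun k => by positivity
  have htN : ∀ k, (t k).toNNReal = (k : ℝ≥0) * P.T / n := fun k => by
    rw [← Real.toNNReal_coe (r := (k : ℝ≥0) * P.T / n)]; simp [ht]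
  have htm : ∀ k, t k ≤ t (k + 1) := fun k => by
    simp only [ht]; gcongr; simp
  set A : ℕ → Set Ω := fun k => {ω | (t k).toNNReal < σ ω} with hA
  have hAm : ∀ k, MeasurableSet[ℱ (t k).toNNReal] (A k) := fun k => by
    have h := (hσ.stopping (t k).toNNReal).compl
    convert h using 1
    ext ω
    simp only [hA, Set.mem_ofPred_eq, Set.mem_compl_iff, not_le]
    exact WithTop.coe_lt_coe.symm
  -- Rounding up does not affect whether a grid date has been passed, so the event that the rounded
  -- time exceeds `t k` is known at `t k`.
  have hAK : ∀ k ω, ω ∈ A k ↔ k < ⌈σ ω * n / P.T⌉₊ := fun k ω => by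
    simp only [hA, Set.mem_ofPred_eq, htN, Nat.lt_ceil]
    rw [div_lt_iff₀ hn', lt_div_iff₀ hT]
  have hK : ∀ ω, ⌈σ ω * n / P.T⌉₊ ≤ n := fun ω => by
    rw [Nat.ceil_le, div_le_iff₀ hT, mul_comm]
    gcongr
    exact hσ.le_deadline ω
  set Y : ℕ → Ω → ℝ := fun k ω => φ (t k) * (if stage N (t k).toNNReal ω = i then 1 else 0)
  have hgrid : ∀ ω, gridCeil P.T n (σ ω) = (t ⌈σ ω * n / P.T⌉₊).toNNReal := fun ω => by
    rw [htN]; rfl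
  -- Telescoping over the grid cells entered before stopping, each increment being multiplied by an
  -- event known at the start of its cell.
  have hpath : ∀ ω, φ (gridCeil P.T n (σ ω)) *
      (if stage N (gridCeil P.T n (σ ω)) ω = i then 1 else 0)
      - φ 0 * (if stage N 0 ω = i then 1 else 0) =
      ∑ k ∈ Finset.range n, (A k).indicator (fun ω => Y (k + 1) ω - Y k ω) ω := by
    intro ω
    have h1 : φ (gridCeil P.T n (σ ω)) *
      (if stage N (gridCeil P.T n (σ ω)) ω = i then 1 else 0) = Y ⌈σ ω * n / P.T⌉₊ ω := by
      simp only [Y, hgrid, Real.coe_toNNReal _ (ht0 _)]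
    have h0 : φ 0 * (if stage N 0 ω = i then 1 else 0) = Y 0 ω := by
      simp [Y, ht]
    rw [h1, h0, ← Finset.sum_range_sub (fun k => Y k ω)]
    rw [← Finset.sum_subset (Finset.range_subset_range.2 (hK ω))]
    · refine Finset.sum_congr rfl fun k hk => ?_
      rw [Set.indicator_of_mem ((hAK k ω).2 (Finset.mem_range.1 hk))]
    · intro k _ hk
      rw [Set.indicator_of_notMem fun h => hk (Finset.mem_range.2 ((hAK k ω).1 h))]
  have hYi : ∀ k, Integrable (Y k) μ := fun k => by
    refine Integrable.const_mul (Integrable.of_bound (Measurable.ite (measurable_stage hN _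
      (measurableSet_singleton i)) measurable_const measurable_const).aestronglyMeasurable 1
      (Filter.Eventually.of_forall fun ω => ?_)) _
    split_ifs <;> simp
  have hYA : ∀ k l, ∫ ω in A l, Y k ω ∂μ =
      φ (t k) * μ.real (A l ∩ {ω | stage N (t k).toNNReal ω = i}) := fun k l => by
    simp only [Y]
    rw [integral_const_mul]
    congr 1
    have : (fun ω => if stage N (t k).toNNReal ω = i then (1 : ℝ) else 0) =
        {ω | stage N (t k).toNNReal ω = i}.indicator 1 := by
      ext ω; simp [Set.indicator_apply]
    have hms : MeasurableSet {ω | stage N (t k).toNNReal ω = i} :=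
      measurable_stage hN _ (measurableSet_singleton i)
    rw [this, integral_indicator_one hms, measureReal_restrict_apply hms, Set.inter_comm]
  simp_rw [hpath]
  have hDi : ∀ k, Integrable ((A k).indicator fun ω => Y (k + 1) ω - Y k ω) μ := fun k =>
    ((hYi (k + 1)).sub (hYi k)).indicator (ℱ.le _ _ (hAm k))
  rw [integral_finsetSum _ fun k _ => hDi k]
  have hT0 : t 0 = 0 := by simp [ht]
  have hTn : t n = P.T := by simp only [ht]; field_simp
  rw [← hT0, ← hTn, ← intervalIntegral.sum_integral_adjacent_intervals]
  · refine Finset.sum_congr rfl fun k _ => ?_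
    rw [integral_indicator (ℱ.le _ _ (hAm k)), integral_sub (hYi _).integrableOn
      (hYi _).integrableOn, hYA, hYA, integral_forward hN (ht0 k) (htm k) (hAm k) hφ hφ' hi]
    refine intervalIntegral.integral_congr_ae (Filter.Eventually.of_forall fun u hu => ?_)
    rw [Set.uIoc_of_le (htm k)] at hu
    -- The rounded time takes grid values only. For `u` in the cell `(t k, t (k + 1)]`, exceeding `t
    -- k` is therefore the same as being at least `u`; this is why the weak inequality appears here.
    have hset : ∀ j, A k ∩ {ω | stage N u.toNNReal ω = j} =
        {ω | u.toNNReal ≤ gridCeil P.T n (σ ω) ∧ stage N u.toNNReal ω = j} := by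
      intro j
      ext ω
      simp only [Set.mem_inter_iff, hAK, Set.mem_ofPred_eq, hgrid]
      refine and_congr_left fun _ => ?_
      rw [Real.toNNReal_le_toNNReal_iff (ht0 _)]
      constructor
      · intro h
        refine hu.2.trans ?_
        simp only [ht]
        gcongr
        exact h
      · intro h
        by_contra h'
        have : t ⌈σ ω * n / P.T⌉₊ ≤ t k := by
          simp only [ht]
          gcongr
          exact not_lt.1 h'
        linarith [hu.1]
    simp only [hset]
  · intro k _
    have hm : Measurable fun ω => gridCeil P.T n (σ ω) :=
      (measurable_gridCeil _ _).comp (measurable_schedule hσ)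
    refine (intervalIntegrable_mul_of_le_one hφ' (measurable_occ_le hN hm i)
      (fun u => abs_measureReal_le_one _) _ _).add
      (intervalIntegrable_mul_of_le_one (continuous_const.mul hφc)
        (measurable_inflow (fun j => measurable_occ_le hN hm j) i)
        (fun u => abs_inflow_le (fun _ => measureReal_nonneg) (fun _ => measureReal_le_one) i) _ _)

/-- Dynkin's formula for the number of completed stages. -/
theorem dynkin [IsProbabilityMeasure μ] {P : Project} (hN : IsPoissonFor lam μ ℱ N)
    {σ : Ω → ℝ≥0} (hσ : P.IsSchedule ℱ σ) {φ φ' : ℝ → ℝ}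
    (hφ : ∀ u, HasDerivAt φ (φ' u) u) (hφ' : Continuous φ') {i : ℕ} (hi : i ≤ 2) :
    ∫ ω, (φ (σ ω) * (if stage N (σ ω) ω = i then 1 else 0)
      - φ 0 * (if stage N 0 ω = i then 1 else 0)) ∂μ =
    ∫ u in (0 : ℝ)..P.T, (φ' u * occ μ N σ i u +
      lam * φ u * inflow (fun j => occ μ N σ j u) i) := by
  have hT := P.T_pos
  have hφc : Continuous φ := continuous_iff_continuousAt.2 fun u => (hφ u).continuousAt
  have hσm := measurable_schedule hσ
  set ρ : ℕ → Ω → ℝ≥0 := fun n ω => gridCeil P.T (n + 1) (σ ω) with hρ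
  have hρm : ∀ n, Measurable (ρ n) := fun n => (measurable_gridCeil _ _).comp hσm
  have hρle : ∀ n ω, σ ω ≤ ρ n ω := fun n ω => le_gridCeil hT n.succ_pos _
  have hρt : ∀ ω, Filter.Tendsto (fun n => ρ n ω) Filter.atTop (nhds (σ ω)) :=
    fun ω => tendsto_gridCeil hT _
  have hρb : ∀ n ω, (ρ n ω : ℝ) ∈ Set.Icc 0 (2 * P.T : ℝ) := fun n ω => by
    refine ⟨NNReal.coe_nonneg _, ?_⟩
    have h1 := gridCeil_le hT n.succ_pos (σ ω)
    have h2 : P.T / (n.succ : ℝ≥0) ≤ P.T :=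
      div_le_self zero_le (by exact_mod_cast n.succ_pos)
    have h3 : ρ n ω ≤ P.T + P.T := h1.trans (add_le_add (hσ.le_deadline ω) h2)
    have : (ρ n ω : ℝ) ≤ P.T + P.T := by exact_mod_cast h3
    linarith
  obtain ⟨C, hC⟩ := (isCompact_Icc (a := (0 : ℝ)) (b := 2 * P.T)).exists_bound_of_continuousOn
    hφc.continuousOn
  have hite : ∀ p : Prop, ∀ [Decidable p], |(if p then (1 : ℝ) else 0)| ≤ 1 := by
    intro p _; split_ifs <;> simp
  have hmite : ∀ {ρ : Ω → ℝ≥0}, Measurable ρ →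
      Measurable fun ω => (if stage N (ρ ω) ω = i then (1 : ℝ) else 0) := fun hρ =>
    Measurable.ite (measurable_stage_at hN hρ (measurableSet_singleton i)) measurable_const
      measurable_const
  have hL : Filter.Tendsto (fun n : ℕ => ∫ ω, (φ (ρ n ω) *
      (if stage N (ρ n ω) ω = i then 1 else 0)
      - φ 0 * (if stage N 0 ω = i then 1 else 0)) ∂μ) Filter.atTop
      (nhds (∫ ω, (φ (σ ω) * (if stage N (σ ω) ω = i then 1 else 0)
      - φ 0 * (if stage N 0 ω = i then 1 else 0)) ∂μ)) := by
    refine tendsto_integral_of_dominated_convergence (fun _ => C + |φ 0|) ?_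
      (integrable_const _) ?_ ?_
    · intro n
      exact (((hφc.measurable.comp (measurable_coe_nnreal_real.comp (hρm n))).mul
        (hmite (hρm n))).sub (measurable_const.mul (hmite measurable_const))).aestronglyMeasurable
    · refine fun n => Filter.Eventually.of_forall fun ω => ?_
      refine (norm_sub_le _ _).trans (add_le_add ?_ ?_)
      · rw [norm_mul]
        exact (mul_le_of_le_one_right (norm_nonneg _) (hite _)).trans (hC _ (hρb n ω))
      · rw [norm_mul]
        exact mul_le_of_le_one_right (norm_nonneg _) (hite _)
    · refine Filter.Eventually.of_forall fun ω => Filter.Tendsto.sub_const ?_ _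
      refine Filter.Tendsto.mul ((hφc.tendsto _).comp
        ((NNReal.continuous_coe.tendsto _).comp (hρt ω))) ?_
      -- The rounded times approach `σ` from above, so right-continuity makes the stage eventually
      -- constant along them.
      refine tendsto_const_nhds.congr' ?_
      have : Filter.Tendsto (fun n => ρ n ω) Filter.atTop
          (nhdsWithin (σ ω) (Set.Ici (σ ω))) :=
        tendsto_nhdsWithin_iff.2 ⟨hρt ω, Filter.Eventually.of_forall fun n => hρle n ω⟩
      filter_upwards [this.eventually (stage_eventually_eq hN ω (σ ω))] with n hn
      rw [hn]
  -- With the weak inequality the events converge for every `u`, since the rounded times lie above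
  -- `σ`.
  set o : (Ω → ℝ≥0) → ℕ → ℝ → ℝ := fun ρ j u =>
    μ.real {ω | u.toNNReal ≤ ρ ω ∧ stage N u.toNNReal ω = j} with ho
  have hot : ∀ j u, Filter.Tendsto (fun n => o (ρ n) j u) Filter.atTop (nhds (o σ j u)) := by
    intro j u
    have hms : ∀ {ρ : Ω → ℝ≥0}, Measurable ρ →
        MeasurableSet {ω | u.toNNReal ≤ ρ ω ∧ stage N u.toNNReal ω = j} := fun h =>
      (measurableSet_le measurable_const h).inter
        (measurable_stage hN _ (measurableSet_singleton j))
    refine (ENNReal.tendsto_toReal (measure_ne_top μ _)).comp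
      (tendsto_measure_of_ae_tendsto_indicator_of_isFiniteMeasure Filter.atTop (hms hσm)
        (fun n => hms (hρm n)) (Filter.Eventually.of_forall fun ω => ?_))
    by_cases h : u.toNNReal ≤ σ ω
    · exact Filter.Eventually.of_forall fun n => by
        simp only [Set.mem_ofPred_eq, h, h.trans (hρle n ω)]
    · filter_upwards [(hρt ω).eventually (gt_mem_nhds (not_le.1 h))] with n hn
      simp only [h, not_le.2 hn]
  obtain ⟨C', hC'⟩ := (isCompact_Icc (a := (0 : ℝ)) (b := P.T)).exists_bound_of_continuousOn
    hφ'.continuousOn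
  obtain ⟨C₂, hC₂⟩ := (isCompact_Icc (a := (0 : ℝ)) (b := P.T)).exists_bound_of_continuousOn
    (continuous_const.mul hφc : Continuous fun u => (lam : ℝ) * φ u).continuousOn
  have hR : Filter.Tendsto (fun n : ℕ => ∫ u in (0 : ℝ)..P.T,
      (φ' u * o (ρ n) i u + lam * φ u * inflow (fun j => o (ρ n) j u) i)) Filter.atTop
      (nhds (∫ u in (0 : ℝ)..P.T,
        (φ' u * o σ i u + lam * φ u * inflow (fun j => o σ j u) i))) := by
    refine intervalIntegral.tendsto_integral_filter_of_dominated_convergence (fun _ => C' + C₂)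
      ?_ ?_ intervalIntegrable_const ?_
    · refine Filter.Eventually.of_forall fun n => Measurable.aestronglyMeasurable ?_
      exact (hφ'.measurable.mul (measurable_occ_le hN (hρm n) i)).add
        ((measurable_const.mul hφc.measurable).mul
          (measurable_inflow (fun j => measurable_occ_le hN (hρm n) j) i))
    · refine Filter.Eventually.of_forall fun n => Filter.Eventually.of_forall fun u hu => ?_
      rw [Set.uIoc_of_le (NNReal.coe_nonneg _)] at hu
      have hu' := Set.Ioc_subset_Icc_self hu
      refine (norm_add_le _ _).trans (add_le_add ?_ ?_)
      · rw [norm_mul]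
        exact (mul_le_of_le_one_right (norm_nonneg _) (abs_measureReal_le_one _)).trans
          (hC' u hu')
      · rw [norm_mul]
        exact (mul_le_of_le_one_right (norm_nonneg _) (abs_inflow_le
          (fun _ => measureReal_nonneg) (fun _ => measureReal_le_one) i)).trans (hC₂ u hu')
    · refine Filter.Eventually.of_forall fun u _ => ?_
      exact ((hot i u).const_mul _).add ((tendsto_inflow (fun j => hot j u) i).const_mul _)
  have heq : ∀ n : ℕ, _ = _ := fun n => dynkin_gridCeil hN hσ hφ hφ' hi n.succ_pos
  have hlim := tendsto_nhds_unique hL (hR.congr fun n => (heq n).symm)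
  rw [hlim]
  refine intervalIntegral.integral_congr_ae ?_
  -- The weak and the strict inequality differ only at atoms of the law of `σ`. There are countably
  -- many, so they do not affect the integral over `u`.
  have hcount : Set.Countable {t : ℝ | 0 < μ {ω | (σ ω : ℝ) = t}} :=
    Measure.countable_meas_level_set_pos (measurable_coe_nnreal_real.comp hσm)
  filter_upwards [hcount.ae_notMem volume] with u hu hu0
  rw [Set.uIoc_of_le (NNReal.coe_nonneg _)] at hu0
  have hz : μ {ω | (σ ω : ℝ) = u} = 0 := by simpa using hu
  have : ∀ j, o σ j u = occ μ N σ j u := by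
    intro j
    refine measureReal_congr ?_
    have hz' : ∀ᵐ ω ∂μ, (σ ω : ℝ) ≠ u := by
      rw [ae_iff]; simpa using hz
    filter_upwards [hz'] with ω hω
    refine propext (and_congr_left fun _ => ⟨fun h => h.lt_of_ne ?_, le_of_lt⟩)
    intro h'
    rw [← h', Real.coe_toNNReal u hu0.1.le] at hω
    exact hω rfl
  simp only [this]

end Dynkin

/-! ### Payoffs as integrals of stage-dependent flows -/

section Payoffs

variable {Ω : Type*} {m : MeasurableSpace Ω} {μ : Measure Ω} {ℱ : Filtration ℝ≥0 m}
  {N : ℝ≥0 → Ω → ℕ} {P : Project}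

/-- Net flow benefit of the principal while the project is in stage `1`. -/
noncomputable def gain (P : Project) : ℝ := P.α * P.v * P.lam - P.c

/-- Net flow cost of the principal while a completed project is not stopped. -/
noncomputable def delayCost (P : Project) : ℝ := P.c + P.r * (P.α * P.v)

/-- Flow benefit of the agent in stage `1`. -/
noncomputable def agentGain (P : Project) : ℝ := P.β * P.c + (1 - P.α) * P.v * P.lam

/-- Flow benefit of the agent while a completed project is not stopped. -/
noncomputable def agentDelay (P : Project) : ℝ := P.β * P.c - P.r * ((1 - P.α) * P.v)

/-- Discounted expected flow at date `u` under `σ`, if stage `i` yields the flow `g i`. -/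
noncomputable def flow (P : Project) {m : MeasurableSpace Ω} (μ : Measure Ω) (N : ℝ≥0 → Ω → ℕ)
    (σ : Ω → ℝ≥0) (g₀ g₁ g₂ : ℝ) (u : ℝ) : ℝ :=
  Real.exp (-P.r * u) * (g₀ * occ μ N σ 0 u + g₁ * occ μ N σ 1 u + g₂ * occ μ N σ 2 u)

/-- Discounted expected flow of the principal. -/
noncomputable def net (P : Project) {m : MeasurableSpace Ω} (μ : Measure Ω) (N : ℝ≥0 → Ω → ℕ)
    (σ : Ω → ℝ≥0) (u : ℝ) : ℝ :=
  P.flow μ N σ (-P.c) P.gain (-P.delayCost) u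

lemma occ_nonneg (σ : Ω → ℝ≥0) (i : ℕ) (u : ℝ) : 0 ≤ occ μ N σ i u := measureReal_nonneg

lemma intervalIntegrable_occ [IsProbabilityMeasure μ] (hN : IsPoissonFor P.lam μ ℱ N)
    {σ : Ω → ℝ≥0} (hσ : P.IsSchedule ℱ σ) {φ : ℝ → ℝ} (hφ : Continuous φ) (i : ℕ) (a b : ℝ) :
    IntervalIntegrable (fun u => φ u * occ μ N σ i u) volume a b :=
  intervalIntegrable_mul_of_le_one hφ (measurable_occ hN (measurable_schedule hσ) i)
    (fun _ => abs_measureReal_le_one _) a b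

lemma continuous_discount (P : Project) : Continuous fun u : ℝ => Real.exp (-P.r * u) := by
  fun_prop

lemma intervalIntegrable_flow [IsProbabilityMeasure μ] (hN : IsPoissonFor P.lam μ ℱ N)
    {σ : Ω → ℝ≥0} (hσ : P.IsSchedule ℱ σ) (g₀ g₁ g₂ a b : ℝ) :
    IntervalIntegrable (P.flow μ N σ g₀ g₁ g₂) volume a b := by
  have h := fun i => intervalIntegrable_occ hN hσ P.continuous_discount i a b
  convert (((h 0).const_mul g₀).add ((h 1).const_mul g₁)).add ((h 2).const_mul g₂) using 1
  ext u
  simp only [flow]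
  ring

lemma integrable_stopped [IsProbabilityMeasure μ] (hN : IsPoissonFor P.lam μ ℱ N)
    {σ : Ω → ℝ≥0} (hσ : P.IsSchedule ℱ σ) {φ : ℝ → ℝ} (hφ : Continuous φ) (i : ℕ) :
    Integrable (fun ω => φ (σ ω) * (if stage N (σ ω) ω = i then (1 : ℝ) else 0)) μ := by
  have hσm := measurable_schedule hσ
  obtain ⟨C, hC⟩ := (isCompact_Icc (a := (0 : ℝ)) (b := P.T)).exists_bound_of_continuousOn
    hφ.continuousOn
  refine Integrable.of_bound ((hφ.measurable.comp (measurable_coe_nnreal_real.comp hσm)).mul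
    (Measurable.ite (measurable_stage_at hN hσm (measurableSet_singleton i)) measurable_const
      measurable_const)).aestronglyMeasurable C (Filter.Eventually.of_forall fun ω => ?_)
  have h := hC (σ ω) ⟨NNReal.coe_nonneg _, by exact_mod_cast hσ.le_deadline ω⟩
  split_ifs
  · simpa using h
  · simpa using (norm_nonneg _).trans h

lemma hasDerivAt_discount (P : Project) (u : ℝ) :
    HasDerivAt (fun u : ℝ => Real.exp (-P.r * u)) (-P.r * Real.exp (-P.r * u)) u := by
  have : HasDerivAt (fun u : ℝ => -P.r * u) (-P.r) u := by
    simpa using! (hasDerivAt_id u).const_mul (-P.r)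
  convert! this.exp using 1; ring

lemma hasDerivAt_annuity (P : Project) (u : ℝ) :
    HasDerivAt P.annuity (Real.exp (-P.r * u)) u := by
  have := ((P.hasDerivAt_discount u).const_sub 1).div_const P.r
  convert! this using 1
  field_simp [P.r_pos.ne']

lemma continuous_annuity (P : Project) : Continuous P.annuity :=
  continuous_iff_continuousAt.2 fun u => (P.hasDerivAt_annuity u).continuousAt

lemma stage_zero (hN : IsPoissonFor P.lam μ ℱ N) (ω : Ω) : stage N 0 ω = 0 := by
  simp [stage, hN.zero]

/-- The project starts in stage 0, so the boundary term at date 0 survives only for `i = 0` with `φ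
0 ≠ 0`. -/
lemma dynkin_of_zero [IsProbabilityMeasure μ] (hN : IsPoissonFor P.lam μ ℱ N)
    {σ : Ω → ℝ≥0} (hσ : P.IsSchedule ℱ σ) {φ φ' : ℝ → ℝ}
    (hφ : ∀ u, HasDerivAt φ (φ' u) u) (hφ' : Continuous φ') {i : ℕ} (hi : i ≤ 2)
    (h0 : φ 0 = 0 ∨ i ≠ 0) :
    ∫ ω, φ (σ ω) * (if stage N (σ ω) ω = i then 1 else 0) ∂μ =
    ∫ u in (0 : ℝ)..P.T, (φ' u * occ μ N σ i u +
      P.lam * φ u * inflow (fun j => occ μ N σ j u) i) := by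
  rw [← dynkin hN hσ hφ hφ' hi]
  refine integral_congr_ae (Filter.Eventually.of_forall fun ω => ?_)
  simp only [stage_zero hN]
  rcases h0 with h | h
  · simp [h]
  · simp [h.symm]

/-- Any linear combination of discounted completion and discounted duration is the value of a
flow that depends on the stage. -/
lemma integral_payoff [IsProbabilityMeasure μ] (hN : IsPoissonFor P.lam μ ℱ N)
    {σ : Ω → ℝ≥0} (hσ : P.IsSchedule ℱ σ) (a b : ℝ) :
    ∫ ω, (a * (Real.exp (-P.r * σ ω) * completed N (σ ω) ω) + b * P.annuity (σ ω)) ∂μ =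
    ∫ u in (0 : ℝ)..P.T, P.flow μ N σ b (a * P.lam + b) (b - P.r * a) u := by
  have hA := fun i => integrable_stopped hN hσ P.continuous_annuity i
  have hE := integrable_stopped hN hσ P.continuous_discount 2
  have hdA := fun i (hi : i ≤ 2) => dynkin_of_zero hN hσ P.hasDerivAt_annuity
    P.continuous_discount hi (Or.inl (by simp [annuity]))
  have hdE := dynkin_of_zero hN hσ P.hasDerivAt_discount
    (continuous_const.mul P.continuous_discount) (le_refl 2) (Or.inr two_ne_zero)
  -- The annuity is split according to the stage at stopping, so that Dynkin's formula applies to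
  -- each part.
  have h1 : ∀ ω, a * (Real.exp (-P.r * σ ω) * completed N (σ ω) ω) + b * P.annuity (σ ω) =
      a * (Real.exp (-P.r * σ ω) * (if stage N (σ ω) ω = 2 then 1 else 0)) +
      b * (P.annuity (σ ω) * (if stage N (σ ω) ω = 0 then 1 else 0) +
        P.annuity (σ ω) * (if stage N (σ ω) ω = 1 then 1 else 0) +
        P.annuity (σ ω) * (if stage N (σ ω) ω = 2 then 1 else 0)) := by
    intro ω
    have := stage_le_two (N := N) (σ ω) ω
    simp only [completed]
    congr 2
    interval_cases stage N (σ ω) ω <;> simp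
  have hS : Integrable (fun ω => P.annuity (σ ω) * (if stage N (σ ω) ω = 0 then 1 else 0) +
        P.annuity (σ ω) * (if stage N (σ ω) ω = 1 then 1 else 0) +
        P.annuity (σ ω) * (if stage N (σ ω) ω = 2 then 1 else 0)) μ :=
    ((hA 0).add (hA 1)).add (hA 2)
  simp_rw [h1]
  rw [integral_add (hE.const_mul a) (hS.const_mul b), integral_const_mul, integral_const_mul]
  rw [show (∫ ω, (P.annuity (σ ω) * (if stage N (σ ω) ω = 0 then 1 else 0) +
        P.annuity (σ ω) * (if stage N (σ ω) ω = 1 then 1 else 0) +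
        P.annuity (σ ω) * (if stage N (σ ω) ω = 2 then 1 else 0)) ∂μ) = _ from
    integral_add ((hA 0).add (hA 1)) (hA 2), integral_add (hA 0) (hA 1), hdE, hdA 0 (by simp),
    hdA 1 (by simp), hdA 2 le_rfl]
  -- The three inflows sum to zero, so all terms with `λ * annuity` cancel and only the derivative
  -- of the annuity remains. For completion, the inflow into stage 2 gives the term `a * λ` in stage
  -- 1.
  simp only [inflow]
  have io := fun {φ : ℝ → ℝ} (hφ : Continuous φ) i =>
    intervalIntegrable_occ hN hσ hφ i 0 P.T
  have c1 := P.continuous_discount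
  have c2 := P.continuous_annuity
  have c3 : Continuous fun u => -P.r * Real.exp (-P.r * u) := by fun_prop
  have c4 : Continuous fun u => (P.lam : ℝ) * Real.exp (-P.r * u) := by fun_prop
  have c5 : Continuous fun u => (P.lam : ℝ) * P.annuity u := by fun_prop
  have c6 : Continuous fun u => (P.lam : ℝ) * P.annuity u * (-1) := by fun_prop
  have i0 : IntervalIntegrable (fun u => Real.exp (-P.r * u) * occ μ N σ 0 u +
      P.lam * P.annuity u * -occ μ N σ 0 u) volume 0 P.T := by
    convert (io c1 0).add (io c6 0) using 1
    ext u; ring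
  have i1 : IntervalIntegrable (fun u => Real.exp (-P.r * u) * occ μ N σ 1 u +
      P.lam * P.annuity u * (occ μ N σ 0 u - occ μ N σ 1 u)) volume 0 P.T := by
    convert (io c1 1).add ((io c5 0).add (io c6 1)) using 1
    ext u; ring
  have i2 := (io c1 2).add (io c5 1)
  have i3 := (io c3 2).add (io c4 1)
  rw [← intervalIntegral.integral_add i0 i1, ← intervalIntegral.integral_add (i0.add i1) i2,
    ← intervalIntegral.integral_const_mul, ← intervalIntegral.integral_const_mul,
    ← intervalIntegral.integral_add (i3.const_mul a) (((i0.add i1).add i2).const_mul b)]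
  refine intervalIntegral.integral_congr fun u _ => ?_
  simp only [flow]
  ring

lemma principalPayoff_eq [IsProbabilityMeasure μ] (hN : IsPoissonFor P.lam μ ℱ N)
    {σ : Ω → ℝ≥0} (hσ : P.IsSchedule ℱ σ) :
    P.principalPayoff μ N σ = ∫ u in (0 : ℝ)..P.T, P.net μ N σ u := by
  have h := integral_payoff hN hσ (P.α * P.v) (-P.c)
  simp only [principalPayoff, sub_eq_add_neg, ← neg_mul] at h ⊢
  rw [h]
  simp only [net, gain, delayCost, neg_add, sub_eq_add_neg, neg_mul]

lemma agentPayoff_eq [IsProbabilityMeasure μ] (hN : IsPoissonFor P.lam μ ℱ N)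
    {σ : Ω → ℝ≥0} (hσ : P.IsSchedule ℱ σ) :
    P.agentPayoff μ N σ =
      ∫ u in (0 : ℝ)..P.T, P.flow μ N σ (P.β * P.c) P.agentGain P.agentDelay u := by
  rw [agentPayoff, integral_payoff hN hσ]
  simp only [agentGain, agentDelay, add_comm]

lemma IsSchedule.min_const {σ : Ω → ℝ≥0} (hσ : P.IsSchedule ℱ σ) (t : ℝ≥0) :
    P.IsSchedule ℱ fun ω => min (σ ω) t where
  stopping := by
    have := hσ.stopping.min (isStoppingTime_const ℱ t)
    convert this using 1
    ext ω : 1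
    exact WithTop.coe_min _ _
  le_deadline ω := (min_le_left _ _).trans (hσ.le_deadline ω)

/-- The contribution of the event that `σ` is still running at `t` to the payoff. -/
lemma setIntegral_continuation [IsProbabilityMeasure μ] (hN : IsPoissonFor P.lam μ ℱ N)
    {σ : Ω → ℝ≥0} (hσ : P.IsSchedule ℱ σ) {t : ℝ≥0} (ht : t ≤ P.T) :
    Real.exp (-P.r * t) * ∫ ω in {ω | t < σ ω},
      (P.α * P.v * (Real.exp (-P.r * ((σ ω : ℝ) - t)) * completed N (σ ω) ω
      - completed N t ω) - P.c * P.annuity ((σ ω : ℝ) - t)) ∂μ =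
    ∫ u in (t : ℝ)..P.T, P.net μ N σ u := by
  -- The discounted continuation integrand on `t < σ` is the difference between the payoff
  -- integrands of `σ` and `min σ t`. The flow of the latter is that of `σ` before `t` and zero
  -- afterwards.
  have hm := hσ.min_const t
  have hσm := measurable_schedule hσ
  have hint : ∀ {ρ : Ω → ℝ≥0}, P.IsSchedule ℱ ρ → Integrable (fun ω =>
      P.α * P.v * (Real.exp (-P.r * ρ ω) * completed N (ρ ω) ω) - P.c * P.annuity (ρ ω)) μ := by
    intro ρ hρ
    refine ((integrable_stopped hN hρ P.continuous_discount 2).const_mul _).sub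
      (Integrable.const_mul ?_ _)
    have h := fun i => integrable_stopped hN hρ P.continuous_annuity i
    refine (((h 0).add (h 1)).add (h 2)).congr (Filter.Eventually.of_forall fun ω => ?_)
    have := stage_le_two (N := N) (ρ ω) ω
    simp only [Pi.add_apply]
    interval_cases stage N (ρ ω) ω <;> simp
  have hV := integral_sub (hint hσ) (hint hm)
  have e1 := principalPayoff_eq hN hσ
  have e2 := principalPayoff_eq hN hm
  rw [principalPayoff] at e1 e2
  rw [e1, e2] at hV
  have hii : ∀ a b, IntervalIntegrable (P.net μ N σ) volume a b :=
    intervalIntegrable_flow hN hσ (-P.c) P.gain (-P.delayCost)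
  have hii' : ∀ a b, IntervalIntegrable (P.net μ N fun ω => min (σ ω) t) volume a b :=
    intervalIntegrable_flow hN hm (-P.c) P.gain (-P.delayCost)
  have hocc : ∀ i (u : ℝ), 0 ≤ u → u < t → occ μ N (fun ω => min (σ ω) t) i u = occ μ N σ i u := by
    intro i u hu0 hu
    have : u.toNNReal < t := by rwa [Real.toNNReal_lt_iff_lt_coe hu0]
    simp [occ, this]
  have hocc' : ∀ i u, (t : ℝ) ≤ u → occ μ N (fun ω => min (σ ω) t) i u = 0 := by
    intro i u hu
    have : ¬ u.toNNReal < t := by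
      rw [not_lt, ← NNReal.coe_le_coe, Real.coe_toNNReal u ((NNReal.coe_nonneg t).trans hu)]
      exact hu
    simp [occ, this]
  have e3 : ∫ u in (0 : ℝ)..P.T, P.net μ N (fun ω => min (σ ω) t) u =
      ∫ u in (0 : ℝ)..t, P.net μ N σ u := by
    rw [← intervalIntegral.integral_add_adjacent_intervals (hii' 0 t) (hii' t P.T)]
    have h1 : ∫ u in (0 : ℝ)..t, P.net μ N (fun ω => min (σ ω) t) u = ∫ u in (0 : ℝ)..t, P.net μ N σ u := by
      refine intervalIntegral.integral_congr_ae ?_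
      filter_upwards [Measure.ae_ne volume (t : ℝ)] with u hu hu'
      rw [Set.uIoc_of_le (NNReal.coe_nonneg _)] at hu'
      have hlt := lt_of_le_of_ne hu'.2 hu
      simp only [net, flow, hocc _ u hu'.1.le hlt]
    have h2 : ∫ u in (t : ℝ)..P.T, P.net μ N (fun ω => min (σ ω) t) u = 0 := by
      rw [← intervalIntegral.integral_zero (μ := volume) (a := (t : ℝ)) (b := P.T)]
      refine intervalIntegral.integral_congr fun u hu => ?_
      rw [Set.uIcc_of_le (by exact_mod_cast ht)] at hu
      simp only [net, flow, hocc' _ u hu.1, mul_zero, add_zero]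
    rw [h1, h2, add_zero]
  rw [e3] at hV
  have e4 := intervalIntegral.integral_add_adjacent_intervals (hii 0 t) (hii t P.T)
  rw [← e4] at hV
  rw [← integral_const_mul, ← integral_indicator (measurableSet_lt measurable_const hσm)]
  refine Eq.trans (integral_congr_ae (Filter.Eventually.of_forall fun ω => ?_))
    (hV.trans (add_sub_cancel_left _ _))
  by_cases h : t < σ ω
  · have hmin : min (σ ω) t = t := min_eq_right h.le
    simp only [Set.indicator_of_mem (show ω ∈ {ω | t < σ ω} from h), hmin, annuity]
    have hE : Real.exp (-P.r * ((σ ω : ℝ) - t)) =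
        Real.exp (-P.r * σ ω) * (Real.exp (-P.r * t))⁻¹ := by
      rw [← Real.exp_neg, ← Real.exp_add]; ring_nf
    rw [hE]
    have := (Real.exp_pos (-P.r * t)).ne'
    field_simp
    ring
  · have hmin : min (σ ω) t = σ ω := min_eq_left (not_lt.1 h)
    simp only [Set.indicator_of_notMem (show ω ∉ {ω | t < σ ω} from h), hmin, sub_self]

/-- Rationality at all dates, in terms of the flows of the principal. -/
lemma isFeasible_iff [IsProbabilityMeasure μ] (hN : IsPoissonFor P.lam μ ℱ N)
    {σ : Ω → ℝ≥0} (hσ : P.IsSchedule ℱ σ) :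
    P.IsFeasible μ ℱ N σ ↔
      ∀ t : ℝ, 0 ≤ t → t ≤ P.T → 0 ≤ ∫ u in t..P.T, P.net μ N σ u := by
  have hc : ∀ t : ℝ≥0, P.continuationValue μ N σ t = (μ {ω | t < σ ω})⁻¹.toReal *
      ∫ ω in {ω | t < σ ω}, (P.α * P.v * (Real.exp (-P.r * ((σ ω : ℝ) - t)) *
        completed N (σ ω) ω - completed N t ω) - P.c * P.annuity ((σ ω : ℝ) - t)) ∂μ := by
    intro t
    rw [continuationValue, ProbabilityTheory.cond, integral_smul_measure, smul_eq_mul]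
  constructor
  · intro hf t ht0 htT
    lift t to ℝ≥0 using ht0
    have htT' : t ≤ P.T := by exact_mod_cast htT
    rw [← setIntegral_continuation hN hσ htT']
    refine mul_nonneg (Real.exp_pos _).le ?_
    -- On a null event the continuation value is zero by convention and carries no information, but
    -- then the tail integral is zero as well.
    rcases eq_or_ne (μ {ω | t < σ ω}) 0 with h0 | h0
    · rw [Measure.restrict_eq_zero.2 h0, integral_zero_measure]
    · have h := hf.rational t
      rw [hc t] at h
      refine nonneg_of_mul_nonneg_right h (ENNReal.toReal_pos ?_ ?_)
      · exact ENNReal.inv_ne_zero.2 (measure_ne_top _ _)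
      · exact ENNReal.inv_ne_top.2 h0
  · intro h
    refine ⟨hσ, fun t => ?_⟩
    rw [hc t]
    refine mul_nonneg ENNReal.toReal_nonneg ?_
    by_cases ht : t ≤ P.T
    · have := h t (NNReal.coe_nonneg t) (by exact_mod_cast ht)
      rw [← setIntegral_continuation hN hσ ht] at this
      exact nonneg_of_mul_nonneg_right this (Real.exp_pos _)
    · have : {ω | t < σ ω} = ∅ := by
        ext ω
        simp only [Set.mem_ofPred_eq, Set.mem_empty_iff_false, iff_false, not_lt]
        exact (hσ.le_deadline ω).trans (not_le.1 ht).le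
      rw [this, setIntegral_empty]

/-- `∫_s^T e^{-(r + λ)(u - s)} du`. -/
noncomputable def horizon (P : Project) (s : ℝ) : ℝ :=
  (1 - Real.exp (-(P.r + P.lam) * (P.T - s))) / (P.r + P.lam)

lemma rate_pos (P : Project) : 0 < P.r + P.lam := by
  have h1 := P.r_pos; have h2 : (0 : ℝ) < P.lam := by exact_mod_cast P.lam_pos
  linarith

lemma horizon_strictAnti (P : Project) : StrictAnti P.horizon := by
  intro a b hab
  have hk := P.rate_pos
  simp only [horizon]
  gcongr 1
  gcongr 1 - ?_
  rw [Real.exp_lt_exp]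
  nlinarith

lemma horizon_deadline (P : Project) : P.horizon P.T = 0 := by simp [horizon]

lemma horizon_nonneg (P : Project) {s : ℝ} (hs : s ≤ P.T) : 0 ≤ P.horizon s := by
  rw [← P.horizon_deadline]; exact P.horizon_strictAnti.antitone hs

lemma horizon_pos (P : Project) {s : ℝ} (hs : s < P.T) : 0 < P.horizon s := by
  rw [← P.horizon_deadline]; exact P.horizon_strictAnti hs

lemma hasDerivAt_horizon (P : Project) (s : ℝ) :
    HasDerivAt P.horizon ((P.r + P.lam) * P.horizon s - 1) s := by
  have hk := P.rate_pos.ne'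
  have h : HasDerivAt (fun s : ℝ => -(P.r + P.lam) * (P.T - s)) (P.r + P.lam) s := by
    simpa using! ((hasDerivAt_id s).const_sub (P.T : ℝ)).const_mul (-(P.r + P.lam : ℝ))
  convert! (h.exp.const_sub 1).div_const (P.r + P.lam : ℝ) using 1
  simp only [horizon]
  field_simp
  ring

lemma continuous_horizon (P : Project) : Continuous P.horizon :=
  continuous_iff_continuousAt.2 fun u => (P.hasDerivAt_horizon u).continuousAt

/-- The time in stage `1` that is forgone by stopping in stage `1` before the deadline. -/
noncomputable def forgone (P : Project) {m : MeasurableSpace Ω} (μ : Measure Ω)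
    (N : ℝ≥0 → Ω → ℕ) (σ : Ω → ℝ≥0) : ℝ :=
  ∫ ω, Real.exp (-P.r * σ ω) * P.horizon (σ ω) * (if stage N (σ ω) ω = 1 then 1 else 0) ∂μ

lemma forgone_integrand_nonneg {σ : Ω → ℝ≥0} (hσ : P.IsSchedule ℱ σ) (ω : Ω) :
    0 ≤ Real.exp (-P.r * σ ω) * P.horizon (σ ω) *
      (if stage N (σ ω) ω = 1 then (1 : ℝ) else 0) := by
  have := P.horizon_nonneg (s := σ ω) (by exact_mod_cast hσ.le_deadline ω)
  positivity

lemma forgone_nonneg {σ : Ω → ℝ≥0} (hσ : P.IsSchedule ℱ σ) : 0 ≤ P.forgone μ N σ :=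
  integral_nonneg fun ω => forgone_integrand_nonneg hσ ω

lemma continuous_discount_mul_horizon (P : Project) :
    Continuous fun u : ℝ => Real.exp (-P.r * u) * P.horizon u :=
  P.continuous_discount.mul P.continuous_horizon

/-- The discounted time in stage `1` in terms of the time in stage `0`. -/
lemma integral_occ_one [IsProbabilityMeasure μ] (hN : IsPoissonFor P.lam μ ℱ N)
    {σ : Ω → ℝ≥0} (hσ : P.IsSchedule ℱ σ) :
    ∫ u in (0 : ℝ)..P.T, Real.exp (-P.r * u) * occ μ N σ 1 u =
      (∫ u in (0 : ℝ)..P.T, P.lam * (Real.exp (-P.r * u) * P.horizon u) * occ μ N σ 0 u)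
        - P.forgone μ N σ := by
  have hd : ∀ u, HasDerivAt (fun u => Real.exp (-P.r * u) * P.horizon u)
      (P.lam * (Real.exp (-P.r * u) * P.horizon u) - Real.exp (-P.r * u)) u := by
    intro u
    convert! (P.hasDerivAt_discount u).mul (P.hasDerivAt_horizon u) using 1
    ring
  have c1 := P.continuous_discount_mul_horizon
  have hc : Continuous fun u : ℝ =>
      P.lam * (Real.exp (-P.r * u) * P.horizon u) - Real.exp (-P.r * u) :=
    (continuous_const.mul c1).sub P.continuous_discount
  have c2 : Continuous fun u => P.lam * (Real.exp (-P.r * u) * P.horizon u) :=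
    continuous_const.mul c1
  have h := dynkin_of_zero hN hσ hd hc one_le_two (Or.inr one_ne_zero)
  rw [forgone, h, ← intervalIntegral.integral_sub]
  · refine intervalIntegral.integral_congr fun u _ => ?_
    simp only [inflow]
    ring
  · exact intervalIntegrable_occ hN hσ c2 0 _ _
  · refine (intervalIntegrable_occ hN hσ hc 1 _ _).add ?_
    convert (intervalIntegrable_occ hN hσ c2 0 _ _).sub
      (intervalIntegrable_occ hN hσ c2 1 _ _) using 1
    ext u
    simp only [inflow]
    ring

/-- The value of a stage-dependent flow, with the flow in stage `1` attributed to the dates at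
which stage `0` is left. -/
lemma integral_flow [IsProbabilityMeasure μ] (hN : IsPoissonFor P.lam μ ℱ N)
    {σ : Ω → ℝ≥0} (hσ : P.IsSchedule ℱ σ) (g₀ g₁ g₂ : ℝ) :
    ∫ u in (0 : ℝ)..P.T, P.flow μ N σ g₀ g₁ g₂ u =
      (∫ u in (0 : ℝ)..P.T, (Real.exp (-P.r * u) * (g₀ + P.lam * g₁ * P.horizon u)) *
        occ μ N σ 0 u) + g₂ * (∫ u in (0 : ℝ)..P.T, Real.exp (-P.r * u) * occ μ N σ 2 u) -
        g₁ * P.forgone μ N σ := by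
  have h := integral_occ_one hN hσ
  have io := fun {φ : ℝ → ℝ} (hφ : Continuous φ) i => intervalIntegrable_occ hN hσ hφ i 0 P.T
  have c0 := P.continuous_discount
  have c1 : Continuous fun u => P.lam * (Real.exp (-P.r * u) * P.horizon u) :=
    continuous_const.mul P.continuous_discount_mul_horizon
  have e : ∀ u, P.flow μ N σ g₀ g₁ g₂ u = g₀ * (Real.exp (-P.r * u) * occ μ N σ 0 u) +
      g₁ * (Real.exp (-P.r * u) * occ μ N σ 1 u) + g₂ * (Real.exp (-P.r * u) * occ μ N σ 2 u) :=
    fun u => by rw [flow]; ring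
  simp_rw [e]
  rw [intervalIntegral.integral_add (((io c0 0).const_mul g₀).add ((io c0 1).const_mul g₁))
    ((io c0 2).const_mul g₂), intervalIntegral.integral_add ((io c0 0).const_mul g₀)
    ((io c0 1).const_mul g₁), intervalIntegral.integral_const_mul g₁, h,
    intervalIntegral.integral_const_mul g₂, mul_sub, ← intervalIntegral.integral_const_mul g₁]
  have : ∫ u in (0 : ℝ)..P.T, (Real.exp (-P.r * u) * (g₀ + P.lam * g₁ * P.horizon u)) *
      occ μ N σ 0 u = (∫ u in (0 : ℝ)..P.T, g₀ * (Real.exp (-P.r * u) * occ μ N σ 0 u)) +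
      ∫ u in (0 : ℝ)..P.T, g₁ * (P.lam * (Real.exp (-P.r * u) * P.horizon u) *
        occ μ N σ 0 u) := by
    rw [← intervalIntegral.integral_add ((io c0 0).const_mul g₀) ((io c1 0).const_mul g₁)]
    refine intervalIntegral.integral_congr fun u _ => ?_
    ring
  rw [this]
  ring

end Payoffs

/-! ### Cutoff schedules and almost sure consequences of null occupation -/

section Cutoffs

variable {Ω : Type*} {m : MeasurableSpace Ω} {μ : Measure Ω} {ℱ : Filtration ℝ≥0 m}
  {N : ℝ≥0 → Ω → ℕ} {P : Project}

/-- The probability of being in stage `i` at date `u` if the project is never stopped. -/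
noncomputable def prob (P : Project) (i : ℕ) (u : ℝ) : ℝ :=
  match i with
  | 0 => Real.exp (-(P.lam * u))
  | 1 => P.lam * u * Real.exp (-(P.lam * u))
  | _ => 1 - (1 + P.lam * u) * Real.exp (-(P.lam * u))

lemma lam_coe_pos (P : Project) : (0 : ℝ) < P.lam := by exact_mod_cast P.lam_pos

lemma deadline_pos (P : Project) : (0 : ℝ) < P.T := by exact_mod_cast P.T_pos

lemma continuous_prob (P : Project) (i : ℕ) : Continuous (P.prob i) := by
  match i with
  | 0 => change Continuous fun u : ℝ => Real.exp (-(P.lam * u)); fun_prop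
  | 1 => change Continuous fun u : ℝ => P.lam * u * Real.exp (-(P.lam * u)); fun_prop
  | (n + 2) =>
    change Continuous fun u : ℝ => 1 - (1 + P.lam * u) * Real.exp (-(P.lam * u))
    fun_prop

lemma measureReal_stage [IsProbabilityMeasure μ] (hN : IsPoissonFor P.lam μ ℱ N) {i : ℕ}
    (hi : i ≤ 2) {u : ℝ} (hu : 0 ≤ u) :
    μ.real {ω | stage N u.toNNReal ω = i} = P.prob i u := by
  have h0 := measureReal_inter_stage_zero hN (zero_le (a := u.toNNReal)) MeasurableSet.univ
  have h1 := measureReal_inter_stage_one hN (zero_le (a := u.toNNReal)) MeasurableSet.univ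
  have h2 := measureReal_eq_sum_stage hN u.toNNReal MeasurableSet.univ
  simp only [Set.univ_inter, stage_zero hN, NNReal.coe_zero, sub_zero, Real.coe_toNNReal u hu]
    at h0 h1 h2
  simp only [Set.ofPred_true,
    show {ω : Ω | (0 : ℕ) = 1} = ∅ by simp, measureReal_empty, probReal_univ, one_mul, zero_add]
    at h0 h1 h2
  interval_cases i
  · exact h0
  · exact h1
  · simp only [prob]
    linarith

lemma prob_zero_pos (P : Project) (u : ℝ) : 0 < P.prob 0 u := Real.exp_pos _

lemma prob_two_pos (P : Project) {u : ℝ} (hu : 0 < u) : 0 < P.prob 2 u := by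
  have h : 0 < P.lam * u := mul_pos P.lam_coe_pos hu
  have h1 := Real.add_one_lt_exp h.ne'
  simp only [prob]
  rw [Real.exp_neg, sub_pos, ← div_eq_mul_inv, div_lt_one (Real.exp_pos _)]
  linarith

lemma occ_le_prob [IsProbabilityMeasure μ] (hN : IsPoissonFor P.lam μ ℱ N) (σ : Ω → ℝ≥0) {i : ℕ}
    (hi : i ≤ 2) {u : ℝ} (hu : 0 ≤ u) : occ μ N σ i u ≤ P.prob i u := by
  rw [← measureReal_stage hN hi hu]
  exact measureReal_mono fun ω h => h.2

/-- An adapted right-continuous increasing family of events is the set of dates after a stopping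
time. -/
lemma exists_schedule_of_events {D : ℝ≥0 → Set Ω} (hD : ∀ t, MeasurableSet[ℱ t] (D t))
    (hmono : Monotone D) (hright : ∀ ω t, ω ∉ D t → ∃ u, t < u ∧ ω ∉ D u)
    (hT : D P.T = Set.univ) : ∃ τ, P.IsSchedule ℱ τ ∧ ∀ ω t, τ ω ≤ t ↔ ω ∈ D t := by
  have key : ∀ ω t, sInf {s | ω ∈ D s} ≤ t ↔ ω ∈ D t := by
    intro ω t
    -- The complement of each path's set of stopped dates is open to the right, so the infimum
    -- belongs to the set.
    refine ⟨fun h => ?_, fun h => csInf_le' h⟩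
    by_contra hn
    obtain ⟨u, htu, hu⟩ := hright ω t hn
    have : u ≤ sInf {s | ω ∈ D s} := by
      refine le_csInf ⟨P.T, by simp [hT]⟩ fun s hs => ?_
      by_contra hsu
      exact hu (hmono (not_le.1 hsu).le hs)
    exact absurd (this.trans h) (not_le.2 htu)
  refine ⟨fun ω => sInf {s | ω ∈ D s}, ⟨fun t => ?_, fun ω => (key ω _).2 (by simp [hT])⟩, key⟩
  convert hD t using 1
  ext ω
  exact WithTop.coe_le_coe.trans (key ω t)

/-- The schedule that stops at the deadline, upon completion but not before `S₁`, and at the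
interim deadline `S₀` if no stage has been completed by then. -/
structure IsCutoff (P : Project) {m : MeasurableSpace Ω} (ℱ : Filtration ℝ≥0 m)
    (N : ℝ≥0 → Ω → ℕ) (S₁ S₀ : ℝ≥0) (τ : Ω → ℝ≥0) : Prop where
  schedule : P.IsSchedule ℱ τ
  lt_iff : ∀ ω t, t < τ ω ↔
    t < P.T ∧ (S₁ ≤ t → stage N t ω ≠ 2) ∧ (S₀ ≤ t → stage N S₀ ω ≠ 0)

/-- `S₁ = 0` stops at completion, and `S₀ = P.T` switches the interim deadline off. The stopped
events are adapted, increase over time and, by right-continuity of the stage, are right-continuous.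
-/
lemma exists_isCutoff (hN : IsPoissonFor P.lam μ ℱ N) (S₁ S₀ : ℝ≥0) :
    ∃ τ, P.IsCutoff ℱ N S₁ S₀ τ := by
  have hset : ∀ t : ℝ≥0, {ω | P.T ≤ t ∨ (S₁ ≤ t ∧ stage N t ω = 2) ∨
      (S₀ ≤ t ∧ stage N S₀ ω = 0)} = {ω | P.T ≤ t} ∪ ({ω | S₁ ≤ t} ∩ {ω | stage N t ω = 2} ∪
        {ω | S₀ ≤ t} ∩ {ω | stage N S₀ ω = 0}) := fun t => by
    ext ω; simp
  set D : ℝ≥0 → Set Ω := fun t =>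
    {ω | P.T ≤ t ∨ (S₁ ≤ t ∧ stage N t ω = 2) ∨ (S₀ ≤ t ∧ stage N S₀ ω = 0)} with hDdef
  have hD : ∀ t, MeasurableSet[ℱ t] (D t) := by
    intro t
    rw [show D t = _ from hset t]
    refine (MeasurableSet.const _).union
      (((MeasurableSet.const _).inter (measurableSet_stage_eq hN t 2)).union ?_)
    by_cases h : S₀ ≤ t
    · exact (MeasurableSet.const _).inter (ℱ.mono h _ (measurableSet_stage_eq hN S₀ 0))
    · simp [h]
  have hmono : Monotone D := by
    intro s t hst ω h
    simp only [hDdef, Set.mem_ofPred_eq] at h ⊢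
    rcases h with h | ⟨h, h'⟩ | ⟨h, h'⟩
    · exact Or.inl (h.trans hst)
    · refine Or.inr (Or.inl ⟨h.trans hst, le_antisymm (stage_le_two _ _) ?_⟩)
      rw [← h']
      exact stage_mono hN ω hst
    · exact Or.inr (Or.inr ⟨h.trans hst, h'⟩)
  have hright : ∀ ω t, ω ∉ D t → ∃ u, t < u ∧ ω ∉ D u := by
    intro ω t h
    simp only [hDdef, Set.mem_ofPred_eq, not_or, not_and, not_le] at h
    obtain ⟨hT, h1, h0⟩ := h
    obtain ⟨v, hv, hs⟩ := exists_stage_eq_of_lt hN ω t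
    -- For `u` strictly between `t` and `w`, the condition `S ≤ u` holds only if `S ≤ t` does, so no
    -- new clause becomes active just after `t`.
    have hex : ∀ S : ℝ≥0, ∃ w, t < w ∧ (t < S → w ≤ S) := fun S => by
      by_cases h : t < S
      · exact ⟨S, h, fun _ => le_rfl⟩
      · exact ⟨t + 1, by simp, fun h' => absurd h' h⟩
    obtain ⟨w₁, hw₁, hw₁'⟩ := hex S₁
    obtain ⟨w₀, hw₀, hw₀'⟩ := hex S₀
    obtain ⟨u, htu, hu⟩ := exists_between (lt_min (lt_min hv hT) (lt_min hw₁ hw₀))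
    simp only [lt_min_iff] at hu
    refine ⟨u, htu, ?_⟩
    simp only [hDdef, Set.mem_ofPred_eq, not_or, not_and, not_le]
    refine ⟨hu.1.2, fun hS => ?_, fun hS => h0 ?_⟩
    · rw [hs u htu.le hu.1.1]
      refine h1 ?_
      by_contra hlt
      exact absurd (hS.trans_lt (hu.2.1.trans_le (hw₁' (not_le.1 hlt)))) (lt_irrefl _)
    · by_contra hlt
      exact absurd (hS.trans_lt (hu.2.2.trans_le (hw₀' (not_le.1 hlt)))) (lt_irrefl _)
  obtain ⟨τ, h1, h2⟩ := exists_schedule_of_events (P := P) hD hmono hright (by simp [hDdef])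
  refine ⟨τ, h1, fun ω t => ?_⟩
  rw [← not_iff_not, not_lt, h2 ω t]
  have := not_lt (a := t) (b := P.T)
  simp only [hDdef, Set.mem_ofPred_eq]
  tauto

namespace IsCutoff

variable {S₁ S₀ : ℝ≥0} {τ : Ω → ℝ≥0}

lemma occ_of_lt [IsProbabilityMeasure μ] (hN : IsPoissonFor P.lam μ ℱ N)
    (h : P.IsCutoff ℱ N S₁ S₀ τ) (hS : S₀ ≤ P.T) {i : ℕ} (hi : i ≤ 2) {u : ℝ} (hu0 : 0 ≤ u)
    (hu : u < S₀) (hu' : i = 2 → u < S₁) : occ μ N τ i u = P.prob i u := by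
  rw [← measureReal_stage hN hi hu0, occ]
  congr 1
  ext ω
  have hlt : u.toNNReal < S₀ := (Real.toNNReal_lt_iff_lt_coe hu0).2 hu
  simp only [Set.mem_ofPred_eq, h.lt_iff]
  refine ⟨fun h => h.2, fun hi' => ⟨⟨hlt.trans_le hS, fun hS₁ h2 => ?_, fun h' =>
    absurd h' (not_le.2 hlt)⟩, hi'⟩⟩
  have : u.toNNReal < S₁ := (Real.toNNReal_lt_iff_lt_coe hu0).2 (hu' (hi'.symm.trans h2))
  exact absurd hS₁ (not_le.2 this)

lemma occ_zero_of_ge (hN : IsPoissonFor P.lam μ ℱ N)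
    (h : P.IsCutoff ℱ N S₁ S₀ τ) {u : ℝ} (hu : S₀ ≤ u) : occ μ N τ 0 u = 0 := by
  have hle : S₀ ≤ u.toNNReal := NNReal.le_toNNReal_of_coe_le hu
  have : {ω | u.toNNReal < τ ω ∧ stage N u.toNNReal ω = 0} = ∅ := by
    ext ω
    simp only [Set.mem_ofPred_eq, h.lt_iff, Set.mem_empty_iff_false, iff_false, not_and]
    rintro ⟨_, _, h2⟩ h0
    have := stage_mono hN ω hle
    simp only [h0] at this
    exact h2 hle (Nat.le_zero.1 this)
  rw [occ, this, measureReal_empty]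

lemma occ_two_of_ge (h : P.IsCutoff ℱ N S₁ S₀ τ) {u : ℝ} (hu : S₁ ≤ u) : occ μ N τ 2 u = 0 := by
  have hle : S₁ ≤ u.toNNReal := NNReal.le_toNNReal_of_coe_le hu
  have : {ω | u.toNNReal < τ ω ∧ stage N u.toNNReal ω = 2} = ∅ := by
    ext ω
    simp only [Set.mem_ofPred_eq, h.lt_iff, Set.mem_empty_iff_false, iff_false, not_and]
    exact fun h' => h'.2.1 hle
  rw [occ, this, measureReal_empty]

/-- A cutoff schedule stops in stage 1 only at the deadline, where `horizon` vanishes. -/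
lemma forgone_eq_zero (h : P.IsCutoff ℱ N S₁ S₀ τ) :
    P.forgone μ N τ = 0 := by
  rw [forgone, ← integral_zero Ω ℝ (μ := μ)]
  refine integral_congr_ae (Filter.Eventually.of_forall fun ω => ?_)
  by_cases h1 : stage N (τ ω) ω = 1
  · have hT : τ ω = P.T := by
      by_contra hne
      have hlt : τ ω < P.T := lt_of_le_of_ne (h.schedule.le_deadline ω) hne
      have hn : ¬ τ ω < τ ω := lt_irrefl _
      rw [h.lt_iff] at hn
      refine hn ⟨hlt, fun _ h2 => by omega, fun hS h0 => ?_⟩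
      have hS' : S₀ < τ ω := lt_of_le_of_ne hS fun heq => by rw [heq] at h0; omega
      exact ((h.lt_iff ω S₀).1 hS').2.2 le_rfl h0
    simp [hT, horizon_deadline]
  · simp [h1]

/-- The value of a flow under an interim deadline, as an integral over stage `0`. -/
lemma integral_flow_eq [IsProbabilityMeasure μ] (hN : IsPoissonFor P.lam μ ℱ N)
    (h : P.IsCutoff ℱ N 0 S₀ τ) (hS : S₀ ≤ P.T) (g₀ g₁ g₂ : ℝ) :
    ∫ u in (0 : ℝ)..P.T, P.flow μ N τ g₀ g₁ g₂ u =
      ∫ u in (0 : ℝ)..S₀, Real.exp (-P.r * u) * (g₀ + P.lam * g₁ * P.horizon u) * P.prob 0 u := by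
  rw [integral_flow hN h.schedule, h.forgone_eq_zero]
  have hS' : (S₀ : ℝ) ≤ P.T := by exact_mod_cast hS
  have hS0 : (0 : ℝ) ≤ S₀ := NNReal.coe_nonneg _
  have h2 : ∫ u in (0 : ℝ)..P.T, Real.exp (-P.r * u) * occ μ N τ 2 u = 0 := by
    refine (intervalIntegral.integral_congr fun u hu => ?_).trans intervalIntegral.integral_zero
    rw [Set.uIcc_of_le P.deadline_pos.le] at hu
    simp only [h.occ_two_of_ge (by simpa using hu.1), mul_zero]
  have hc : Continuous fun u => Real.exp (-P.r * u) * (g₀ + P.lam * g₁ * P.horizon u) :=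
    P.continuous_discount.mul (continuous_const.add (continuous_const.mul P.continuous_horizon))
  have hii := fun a b => intervalIntegrable_occ hN h.schedule hc 0 a b
  rw [h2, ← intervalIntegral.integral_add_adjacent_intervals (hii 0 S₀) (hii S₀ P.T)]
  have h3 : ∫ u in (S₀ : ℝ)..P.T, Real.exp (-P.r * u) * (g₀ + P.lam * g₁ * P.horizon u) *
      occ μ N τ 0 u = 0 := by
    refine (intervalIntegral.integral_congr fun u hu => ?_).trans intervalIntegral.integral_zero
    rw [Set.uIcc_of_le hS'] at hu
    simp only [h.occ_zero_of_ge hN hu.1, mul_zero]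
  rw [h3, mul_zero, mul_zero, add_zero, add_zero, sub_zero]
  refine intervalIntegral.integral_congr_ae ?_
  filter_upwards [Measure.ae_ne volume (S₀ : ℝ)] with u hne hu
  rw [Set.uIoc_of_le hS0] at hu
  rw [h.occ_of_lt hN hS (by norm_num) hu.1.le (lt_of_le_of_ne hu.2 hne) (by norm_num)]

/-- An interim deadline is rational at all dates if it is at date `0`. -/
lemma isFeasible [IsProbabilityMeasure μ] (hN : IsPoissonFor P.lam μ ℱ N)
    (h : P.IsCutoff ℱ N 0 S₀ τ) (hS : S₀ ≤ P.T) (hg : 0 < P.gain)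
    (h0 : 0 ≤ ∫ u in (0 : ℝ)..P.T, P.net μ N τ u) : P.IsFeasible μ ℱ N τ := by
  rw [isFeasible_iff hN h.schedule]
  intro t ht0 htT
  have hlam := P.lam_coe_pos
  have hnet : ∀ u : ℝ, 0 ≤ u → P.net μ N τ u =
      Real.exp (-P.r * u) * (P.gain * occ μ N τ 1 u - P.c * occ μ N τ 0 u) := by
    intro u hu
    rw [net, flow, h.occ_two_of_ge (by simpa using hu)]
    ring
  have hlt : ∀ u : ℝ, 0 ≤ u → u < S₀ → P.net μ N τ u =
      Real.exp (-P.r * u) * ((P.gain * (P.lam * u) - P.c) * Real.exp (-(P.lam * u))) := by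
    intro u hu hu'
    rw [hnet u hu, h.occ_of_lt hN hS (by norm_num) hu hu' (by norm_num),
      h.occ_of_lt hN hS (by norm_num) hu hu' (by norm_num)]
    simp only [prob]
    ring
  have hge : ∀ u : ℝ, 0 ≤ u → S₀ ≤ u → 0 ≤ P.net μ N τ u := by
    intro u hu hu'
    rw [hnet u hu, h.occ_zero_of_ge hN hu', mul_zero, sub_zero]
    have := occ_nonneg (μ := μ) (N := N) τ 1 u
    positivity
  -- The principal's flow changes sign at most once, from negative to nonnegative. A tail either
  -- consists of nonnegative flow or equals the nonnegative total minus a nonpositive head.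
  by_cases hcase : (S₀ : ℝ) ≤ t ∨ P.c ≤ P.gain * (P.lam * t)
  · refine intervalIntegral.integral_nonneg htT fun u hu => ?_
    have hu0 := ht0.trans hu.1
    by_cases hu' : (S₀ : ℝ) ≤ u
    · exact hge u hu0 hu'
    · rw [hlt u hu0 (not_le.1 hu')]
      rcases hcase with hc | hc
      · exact absurd (hc.trans hu.1) hu'
      · have : P.gain * (P.lam * t) ≤ P.gain * (P.lam * u) := by
          have := hu.1
          gcongr
        have h3 : 0 ≤ P.gain * (P.lam * u) - P.c := by linarith
        positivity
  · push Not at hcase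
    have hii := intervalIntegrable_flow hN h.schedule (-P.c) P.gain (-P.delayCost)
    have hsplit := intervalIntegral.integral_add_adjacent_intervals (hii 0 t) (hii t P.T)
    have hneg : ∫ u in (0 : ℝ)..t, P.net μ N τ u ≤ 0 := by
      rw [← neg_nonneg, ← intervalIntegral.integral_neg]
      refine intervalIntegral.integral_nonneg ht0 fun u hu => neg_nonneg.2 ?_
      rw [hlt u hu.1 (hu.2.trans_lt hcase.1)]
      have : P.gain * (P.lam * u) ≤ P.gain * (P.lam * t) := by
        have := hu.2
        gcongr
      refine mul_nonpos_of_nonneg_of_nonpos (Real.exp_pos _).le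
        (mul_nonpos_of_nonpos_of_nonneg (by linarith [hcase.2]) (Real.exp_pos _).le)
    simp only [net] at h0 hneg ⊢
    linarith

end IsCutoff

/-- If almost all time sections of `Z` are null, then almost no path of `Z` contains an
interval. -/
lemma ae_forall_exists_notMem [IsProbabilityMeasure μ] {Z : Set (ℝ × Ω)} (hZ : MeasurableSet Z)
    {a b : ℝ} (h : ∀ᵐ u ∂volume, u ∈ Set.Ioo a b → μ.real {ω | (u, ω) ∈ Z} = 0) :
    ∀ᵐ ω ∂μ, ∀ s t, s < t → a ≤ s → t ≤ b → ∃ u ∈ Set.Ioo s t, (u, ω) ∉ Z := by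
  have hm : MeasurableSet (Z ∩ Set.Ioo a b ×ˢ Set.univ) :=
    hZ.inter (measurableSet_Ioo.prod MeasurableSet.univ)
  have h1 : (volume.prod μ) (Z ∩ Set.Ioo a b ×ˢ Set.univ) = 0 := by
    rw [Measure.measure_prod_null hm]
    filter_upwards [h] with u hu
    by_cases hu' : u ∈ Set.Ioo a b
    · have : Prod.mk u ⁻¹' (Z ∩ Set.Ioo a b ×ˢ Set.univ) = {ω | (u, ω) ∈ Z} := by
        ext ω; simp only [Set.mem_preimage, Set.mem_inter_iff, Set.mem_prod, Set.mem_univ,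
          and_true, hu', Set.mem_ofPred_eq]
      rw [this, Pi.zero_apply]
      exact (measureReal_eq_zero_iff (measure_ne_top _ _)).1 (hu hu')
    · have : Prod.mk u ⁻¹' (Z ∩ Set.Ioo a b ×ˢ Set.univ) = ∅ := by
        ext ω; simp only [Set.mem_preimage, Set.mem_inter_iff, Set.mem_prod, hu', false_and,
          and_false, Set.mem_empty_iff_false]
      rw [this, measure_empty, Pi.zero_apply]
  -- By Fubini, almost every path section is Lebesgue null and so contains no interval.
  have h2 : (μ.prod volume) (Prod.swap ⁻¹' (Z ∩ Set.Ioo a b ×ˢ Set.univ)) = 0 := by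
    rw [← Measure.map_apply measurable_swap hm, Measure.prod_swap, h1]
  have h3 : ∀ᵐ z ∂μ.prod volume, Prod.swap z ∉ Z ∩ Set.Ioo a b ×ˢ (Set.univ : Set Ω) :=
    measure_eq_zero_iff_ae_notMem.1 h2
  filter_upwards [Measure.ae_ae_of_ae_prod h3] with ω hω s t hst has htb
  by_contra! hn
  have hpos : volume (Set.Ioo s t) ≠ 0 := by simp [hst]
  refine hpos (measure_mono_null (fun u hu => ?_) (ae_iff.1 hω))
  exact not_not.2 ⟨hn u hu, ⟨has.trans_lt hu.1, hu.2.trans_le htb⟩, trivial⟩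

lemma occ_add_stopped [IsProbabilityMeasure μ] (hN : IsPoissonFor P.lam μ ℱ N)
    {σ : Ω → ℝ≥0} (hσ : P.IsSchedule ℱ σ) {i : ℕ} (hi : i ≤ 2) {u : ℝ} (hu : 0 ≤ u) :
    occ μ N σ i u + μ.real {ω | σ ω ≤ u.toNNReal ∧ stage N u.toNNReal ω = i} = P.prob i u := by
  rw [← measureReal_stage hN hi hu, occ, ← measureReal_union]
  · congr 1
    ext ω
    simp only [Set.mem_union, Set.mem_ofPred_eq, ← or_and_right, lt_or_ge, true_and]
  · refine Set.disjoint_left.2 ?_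
    rintro ω ⟨h, _⟩ ⟨h', _⟩
    exact absurd h' (not_le.2 h)
  · exact (measurableSet_le (measurable_schedule hσ) measurable_const).inter
      (measurable_stage hN _ (measurableSet_singleton i))

lemma measurableSet_stopped (hN : IsPoissonFor P.lam μ ℱ N) {σ : Ω → ℝ≥0}
    (hσ : P.IsSchedule ℱ σ) (i : ℕ) :
    MeasurableSet {p : ℝ × Ω | σ p.2 ≤ p.1.toNNReal ∧ stage N p.1.toNNReal p.2 = i} :=
  (measurableSet_le ((measurable_schedule hσ).comp measurable_snd)
    (measurable_real_toNNReal.comp measurable_fst)).inter (measurableSet_stage_path hN i)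

/-- If almost never the project rests in stage `i` after `σ`, then `σ` is not in stage `i`. -/
lemma ae_stage_ne_of_stopped_null [IsProbabilityMeasure μ] (hN : IsPoissonFor P.lam μ ℱ N)
    {σ : Ω → ℝ≥0} (hσ : P.IsSchedule ℱ σ) {i : ℕ} {b : ℝ≥0}
    (h : ∀ᵐ u ∂volume, u ∈ Set.Ioo (0 : ℝ) b →
      μ.real {ω | σ ω ≤ u.toNNReal ∧ stage N u.toNNReal ω = i} = 0) :
    ∀ᵐ ω ∂μ, σ ω < b → stage N (σ ω) ω ≠ i := by
  filter_upwards [ae_forall_exists_notMem (measurableSet_stopped hN hσ i) h] with ω hω hb hi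
  -- After stopping in stage `i` the path stays there for an interval, which would lie in the
  -- excluded set.
  obtain ⟨v, hv, hs⟩ := exists_stage_eq_of_lt hN ω (σ ω)
  obtain ⟨u, hu, hn⟩ := hω (σ ω) (min v b : ℝ≥0) (by exact_mod_cast lt_min hv hb)
    (NNReal.coe_nonneg _) (by exact_mod_cast min_le_right v b)
  have hu0 : 0 ≤ u := (NNReal.coe_nonneg _).trans hu.1.le
  lift u to ℝ≥0 using hu0
  have hu1 : σ ω < u := by exact_mod_cast hu.1
  have hu2 : u < min v b := by exact_mod_cast hu.2
  refine hn ?_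
  simp only [Real.toNNReal_coe]
  exact ⟨hu1.le, (hs u hu1.le (hu2.trans_le (min_le_left _ _))).trans hi⟩

/-- If almost never the project is in stage `i` while `σ` is running after `b`, then `σ` has
stopped by `b` if the stage is `i` at `b`. -/
lemma ae_le_of_running_null [IsProbabilityMeasure μ] (hN : IsPoissonFor P.lam μ ℱ N)
    {σ : Ω → ℝ≥0} (hσ : P.IsSchedule ℱ σ) {i : ℕ} {b : ℝ≥0}
    (h : ∀ᵐ u ∂volume, u ∈ Set.Ioo (b : ℝ) P.T → occ μ N σ i u = 0) :
    ∀ᵐ ω ∂μ, stage N b ω = i → σ ω ≤ b := by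
  filter_upwards [ae_forall_exists_notMem
    (measurableSet_running hN (measurable_schedule hσ) i) h] with ω hω hi
  by_contra! hb
  obtain ⟨v, hv, hs⟩ := exists_stage_eq_of_lt hN ω b
  have hmT : min v (σ ω) ≤ P.T := (min_le_right _ _).trans (hσ.le_deadline ω)
  obtain ⟨u, hu, hn⟩ := hω b (min v (σ ω) : ℝ≥0) (by exact_mod_cast lt_min hv hb)
    le_rfl (by exact_mod_cast hmT)
  have hu0 : 0 ≤ u := (NNReal.coe_nonneg _).trans hu.1.le
  lift u to ℝ≥0 using hu0
  have hu1 : b < u := by exact_mod_cast hu.1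
  have hu2 : u < min v (σ ω) := by exact_mod_cast hu.2
  refine hn ?_
  simp only [Real.toNNReal_coe]
  exact ⟨hu2.trans_le (min_le_right _ _),
    (hs u hu1.le (hu2.trans_le (min_le_left _ _))).trans hi⟩

/-- A nonnegative function with nonpositive integral vanishes almost everywhere. -/
lemma ae_eq_zero_of_integral_nonpos {f : ℝ → ℝ} {a b : ℝ} (hab : a ≤ b)
    (hf : IntervalIntegrable f volume a b) (h0 : ∀ u, a ≤ u → u ≤ b → 0 ≤ f u)
    (h : ∫ u in a..b, f u ≤ 0) : ∀ᵐ u ∂volume, u ∈ Set.Ioo a b → f u = 0 := by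
  have hnn : 0 ≤ᵐ[volume.restrict (Set.Ioc a b)] f := by
    filter_upwards [ae_restrict_mem measurableSet_Ioc] with u hu using h0 u hu.1.le hu.2
  have hz := (intervalIntegral.integral_eq_zero_iff_of_le_of_nonneg_ae hab hnn hf).1
    (le_antisymm h (intervalIntegral.integral_nonneg hab fun u hu => h0 u hu.1 hu.2))
  filter_upwards [(ae_restrict_iff' measurableSet_Ioc).1 hz] with u hu hu'
  exact hu (Set.Ioo_subset_Ioc_self hu')

end Cutoffs

/-! ### The two cutoffs and the cost of stopping before completion -/

section Thresholds

variable {Ω : Type*} {m : MeasurableSpace Ω} {μ : Measure Ω} {ℱ : Filtration ℝ≥0 m}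
  {N : ℝ≥0 → Ω → ℕ} {P : Project}

/-- Discounted expected duration of stage `0` before the deadline. -/
noncomputable def timeZero (T lam : ℝ≥0) (r : ℝ) : ℝ :=
  (1 - Real.exp (-(r + lam) * T)) / (r + lam)

/-- Discounted expected duration of stage `1` before the deadline. -/
noncomputable def timeOne (T lam : ℝ≥0) (r : ℝ) : ℝ :=
  lam * (1 - Real.exp (-(r + lam) * T) * (1 + (r + lam) * T)) / (r + lam) ^ 2

/-- The cutoff below which investing until completion or the deadline is profitable. -/
noncomputable def noInterimCutoff (T lam : ℝ≥0) (r α : ℝ) : ℝ :=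
  α * timeOne T lam r / (timeZero T lam r + timeOne T lam r)

/-- The cutoff below which some investment is profitable. -/
noncomputable def fullInfoCutoff (T lam : ℝ≥0) (r α : ℝ) : ℝ :=
  α * (lam * timeZero T lam r) / (1 + lam * timeZero T lam r)

lemma timeZero_eq_horizon (P : Project) : timeZero P.T P.lam P.r = P.horizon 0 := by
  simp [timeZero, horizon]

lemma timeZero_pos (P : Project) : 0 < timeZero P.T P.lam P.r := by
  rw [timeZero_eq_horizon]; exact P.horizon_pos P.deadline_pos

lemma timeOne_pos (P : Project) : 0 < timeOne P.T P.lam P.r := by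
  have hk := P.rate_pos
  have hl := P.lam_coe_pos
  have hkT : 0 < (P.r + P.lam) * P.T := mul_pos hk P.deadline_pos
  have h := Real.add_one_lt_exp hkT.ne'
  have : Real.exp (-(P.r + P.lam) * P.T) * (1 + (P.r + P.lam) * P.T) < 1 := by
    rw [neg_mul, Real.exp_neg, inv_mul_lt_iff₀ (Real.exp_pos _)]
    linarith
  have h1 : 0 < 1 - Real.exp (-(P.r + P.lam) * P.T) * (1 + (P.r + P.lam) * P.T) := by linarith
  simp only [timeOne]
  positivity

/-- This is the order of the two cutoffs after cross-multiplication. With `x = (r + λ) * T` it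
reduces to `1 - x < e^{-x}`. -/
lemma timeOne_lt (P : Project) :
    timeOne P.T P.lam P.r < P.lam * timeZero P.T P.lam P.r ^ 2 := by
  have hk := P.rate_pos
  have hl := P.lam_coe_pos
  have hkT : 0 < (P.r + P.lam) * P.T := mul_pos hk P.deadline_pos
  have h := Real.add_one_lt_exp (neg_ne_zero.2 hkT.ne')
  simp only [timeOne, timeZero, neg_mul]
  have hy := Real.exp_pos (-((P.r + P.lam) * P.T))
  rw [div_pow, ← mul_div_assoc]
  gcongr 1
  gcongr
  nlinarith

lemma noInterimCutoff_pos (P : Project) : 0 < noInterimCutoff P.T P.lam P.r P.α := by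
  have h1 := P.timeZero_pos; have h2 := P.timeOne_pos; have h3 := P.α_pos
  simp only [noInterimCutoff]
  positivity

lemma noInterimCutoff_lt_fullInfoCutoff (P : Project) :
    noInterimCutoff P.T P.lam P.r P.α < fullInfoCutoff P.T P.lam P.r P.α := by
  have h1 := P.timeZero_pos; have h2 := P.timeOne_pos; have h3 := P.α_pos
  have hl := P.lam_coe_pos
  have h4 := P.timeOne_lt
  simp only [noInterimCutoff, fullInfoCutoff]
  rw [div_lt_div_iff₀ (by positivity) (by positivity)]
  nlinarith [mul_pos h3 (sub_pos.2 h4)]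

lemma κ_lt_fullInfoCutoff_iff (P : Project) :
    P.κ < fullInfoCutoff P.T P.lam P.r P.α ↔ 0 < -P.c + P.lam * P.gain * P.horizon 0 := by
  have h1 := P.timeZero_pos; have hl := P.lam_coe_pos; have hv := P.v_pos
  rw [← timeZero_eq_horizon]
  simp only [κ, fullInfoCutoff, gain]
  rw [div_lt_div_iff₀ (by positivity) (by positivity), ← sub_pos,
    show P.α * (P.lam * timeZero P.T P.lam P.r) * (P.v * P.lam) -
      P.c * (1 + P.lam * timeZero P.T P.lam P.r) =
      -P.c + P.lam * (P.α * P.v * P.lam - P.c) * timeZero P.T P.lam P.r by ring]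

/-- The right-hand side is the principal's value of stopping only at completion or the deadline, by
`integral_baseFlow`. -/
lemma κ_le_noInterimCutoff_iff (P : Project) :
    P.κ ≤ noInterimCutoff P.T P.lam P.r P.α ↔
      0 ≤ P.gain * timeOne P.T P.lam P.r - P.c * timeZero P.T P.lam P.r := by
  have h1 := P.timeZero_pos; have hl := P.lam_coe_pos; have hv := P.v_pos
  have h2 := P.timeOne_pos
  simp only [κ, noInterimCutoff, gain]
  rw [div_le_div_iff₀ (by positivity) (by positivity), ← sub_nonneg,
    show P.α * timeOne P.T P.lam P.r * (P.v * P.lam) -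
      P.c * (timeZero P.T P.lam P.r + timeOne P.T P.lam P.r) =
      (P.α * P.v * P.lam - P.c) * timeOne P.T P.lam P.r - P.c * timeZero P.T P.lam P.r by ring]

lemma delayCost_pos (P : Project) : 0 < P.delayCost := by
  have := P.c_pos; have := P.r_pos; have := P.α_pos; have := P.v_pos
  simp only [delayCost]; positivity

/-- The exclusion of `α = 1` together with `β = 0` enters here: time in stage 1 is strictly valuable
to the agent, which makes the conclusions hold for every optimal schedule. -/
lemma agentGain_pos (P : Project) (h : ¬ (P.α = 1 ∧ P.β = 0)) : 0 < P.agentGain := by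
  have hc := P.c_pos; have hb := P.β_nonneg; have hv := P.v_pos; have hl := P.lam_coe_pos
  have ha := P.α_le_one
  have h1 : 0 ≤ P.β * P.c := by positivity
  have h2 : 0 ≤ (1 - P.α) * P.v * P.lam := by
    have : 0 ≤ 1 - P.α := by linarith
    positivity
  simp only [agentGain]
  rcases ha.lt_or_eq with h3 | h3
  · have : 0 < (1 - P.α) * P.v * P.lam := by
      have : 0 < 1 - P.α := by linarith
      positivity
    linarith
  · have : 0 < P.β := lt_of_le_of_ne hb fun h4 => h ⟨h3, h4.symm⟩
    have : 0 < P.β * P.c := by positivity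
    linarith

/-- Principal's flow if the project is stopped exactly upon completion or at the deadline. -/
noncomputable def baseFlow (P : Project) (u : ℝ) : ℝ :=
  Real.exp (-P.r * u) * (-P.c * P.prob 0 u + P.gain * P.prob 1 u)

lemma continuous_baseFlow (P : Project) : Continuous P.baseFlow :=
  P.continuous_discount.mul ((continuous_const.mul (P.continuous_prob 0)).add
    (continuous_const.mul (P.continuous_prob 1)))

lemma IsCutoff.flow_eq [IsProbabilityMeasure μ] (hN : IsPoissonFor P.lam μ ℱ N) {S : ℝ≥0}
    {τ : Ω → ℝ≥0} (h : P.IsCutoff ℱ N S P.T τ) (g₀ g₁ g₂ : ℝ) {u : ℝ} (hu0 : 0 ≤ u)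
    (hu : u < P.T) : P.flow μ N τ g₀ g₁ g₂ u =
      Real.exp (-P.r * u) * (g₀ * P.prob 0 u + g₁ * P.prob 1 u +
        g₂ * (if u < S then P.prob 2 u else 0)) := by
  rw [flow, h.occ_of_lt hN le_rfl (by norm_num) hu0 hu (by norm_num),
    h.occ_of_lt hN le_rfl (by norm_num) hu0 hu (by norm_num)]
  split_ifs with hS
  · rw [h.occ_of_lt hN le_rfl (by norm_num) hu0 hu fun _ => hS]
  · rw [h.occ_two_of_ge (not_lt.1 hS)]

lemma IsCutoff.integral_net_of_ge [IsProbabilityMeasure μ] (hN : IsPoissonFor P.lam μ ℱ N)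
    {S : ℝ≥0} {τ : Ω → ℝ≥0} (h : P.IsCutoff ℱ N S P.T τ) {t : ℝ} (ht : S ≤ t) (htT : t ≤ P.T) :
    ∫ u in t..P.T, P.net μ N τ u = ∫ u in t..P.T, P.baseFlow u := by
  have ht0 : 0 ≤ t := (NNReal.coe_nonneg _).trans ht
  refine intervalIntegral.integral_congr_ae ?_
  filter_upwards [Measure.ae_ne volume (P.T : ℝ)] with u hne hu
  rw [Set.uIoc_of_le htT] at hu
  rw [net, h.flow_eq hN _ _ _ (ht0.trans hu.1.le) (lt_of_le_of_ne hu.2 hne),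
    if_neg (not_lt.2 (ht.trans hu.1.le)), baseFlow, mul_zero, add_zero]

lemma IsCutoff.integral_net_of_le [IsProbabilityMeasure μ] (hN : IsPoissonFor P.lam μ ℱ N)
    {S : ℝ≥0} {τ : Ω → ℝ≥0} (h : P.IsCutoff ℱ N S P.T τ) (hS : S ≤ P.T) {t : ℝ} (ht0 : 0 ≤ t)
    (ht : t ≤ S) :
    ∫ u in t..P.T, P.net μ N τ u = (∫ u in t..P.T, P.baseFlow u) -
      ∫ u in t..S, P.delayCost * (Real.exp (-P.r * u) * P.prob 2 u) := by
  have hS' : (S : ℝ) ≤ P.T := by exact_mod_cast hS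
  have hii : ∀ a b, IntervalIntegrable (P.net μ N τ) volume a b :=
    intervalIntegrable_flow hN h.schedule (-P.c) P.gain (-P.delayCost)
  have hb := fun a b => P.continuous_baseFlow.intervalIntegrable (μ := volume) a b
  have hq : Continuous fun u => P.delayCost * (Real.exp (-P.r * u) * P.prob 2 u) :=
    continuous_const.mul (P.continuous_discount.mul (P.continuous_prob 2))
  rw [← intervalIntegral.integral_add_adjacent_intervals (hii t S) (hii S P.T),
    ← intervalIntegral.integral_add_adjacent_intervals (hb t S) (hb S P.T)]
  have h1 := h.integral_net_of_ge hN le_rfl hS'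
  have h2 : ∫ u in t..S, P.net μ N τ u = (∫ u in t..S, P.baseFlow u) -
      ∫ u in t..S, P.delayCost * (Real.exp (-P.r * u) * P.prob 2 u) := by
    rw [← intervalIntegral.integral_sub (hb t S) (hq.intervalIntegrable _ _)]
    refine intervalIntegral.integral_congr_ae ?_
    filter_upwards [Measure.ae_ne volume (S : ℝ)] with u hne hu
    rw [Set.uIoc_of_le ht] at hu
    have hlt := lt_of_le_of_ne hu.2 hne
    rw [net, h.flow_eq hN _ _ _ (ht0.trans hu.1.le) (hlt.trans_le hS'), if_pos hlt, baseFlow]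
    ring
  rw [h1, h2]
  ring

lemma integral_baseFlow (P : Project) : ∫ u in (0 : ℝ)..P.T, P.baseFlow u =
    P.gain * timeOne P.T P.lam P.r - P.c * timeZero P.T P.lam P.r := by
  have hk := P.rate_pos.ne'
  have hE : ∀ u, HasDerivAt (fun u : ℝ => Real.exp (-(P.r + P.lam) * u))
      (-(P.r + P.lam) * Real.exp (-(P.r + P.lam) * u)) u := by
    intro u
    have : HasDerivAt (fun u : ℝ => -(P.r + P.lam : ℝ) * u) (-(P.r + P.lam)) u := by
      simpa using! (hasDerivAt_id u).const_mul (-(P.r + P.lam : ℝ))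
    convert! this.exp using 1; ring
  have hL : ∀ u, HasDerivAt (fun u : ℝ => 1 + (P.r + P.lam : ℝ) * u) (P.r + P.lam) u := by
    intro u
    simpa using! ((hasDerivAt_id u).const_mul (P.r + P.lam : ℝ)).const_add 1
  have hd : ∀ u ∈ Set.uIcc (0 : ℝ) P.T, HasDerivAt (fun u : ℝ =>
      P.c / (P.r + P.lam) * Real.exp (-(P.r + P.lam) * u) -
      P.gain * P.lam / (P.r + P.lam) ^ 2 *
        (Real.exp (-(P.r + P.lam) * u) * (1 + (P.r + P.lam) * u))) (P.baseFlow u) u := by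
    intro u _
    convert! ((hE u).const_mul (P.c / (P.r + P.lam))).sub
      (((hE u).mul (hL u)).const_mul (P.gain * P.lam / (P.r + P.lam) ^ 2)) using 1
    have : Real.exp (-(P.r + P.lam) * u) = Real.exp (-P.r * u) * Real.exp (-(P.lam * u)) := by
      rw [← Real.exp_add]; ring_nf
    rw [this]
    simp only [baseFlow, prob]
    field_simp
    ring
  rw [intervalIntegral.integral_eq_sub_of_hasDerivAt hd
    (P.continuous_baseFlow.intervalIntegrable _ _)]
  simp only [timeOne, timeZero, mul_zero, Real.exp_zero]
  field_simp
  ring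

/-- Discounted expected time in stage `1` that is lost to stopping. -/
noncomputable def lostTime (P : Project) {m : MeasurableSpace Ω} (μ : Measure Ω)
    (N : ℝ≥0 → Ω → ℕ) (σ : Ω → ℝ≥0) : ℝ :=
  ∫ u in (0 : ℝ)..P.T, Real.exp (-P.r * u) * (P.prob 1 u - occ μ N σ 1 u)

lemma intervalIntegrable_mul_prob (P : Project) {φ : ℝ → ℝ} (hφ : Continuous φ) (i : ℕ)
    (a b : ℝ) : IntervalIntegrable (fun u => φ u * P.prob i u) volume a b :=
  (hφ.mul (P.continuous_prob i)).intervalIntegrable a b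

lemma intervalIntegrable_lost [IsProbabilityMeasure μ] (hN : IsPoissonFor P.lam μ ℱ N)
    {σ : Ω → ℝ≥0} (hσ : P.IsSchedule ℱ σ) {φ : ℝ → ℝ} (hφ : Continuous φ) (i : ℕ) (a b : ℝ) :
    IntervalIntegrable (fun u => φ u * (P.prob i u - occ μ N σ i u)) volume a b := by
  convert (P.intervalIntegrable_mul_prob hφ i a b).sub
    (intervalIntegrable_occ hN hσ hφ i a b) using 1
  ext u
  simp only [mul_sub]

lemma lostTime_nonneg [IsProbabilityMeasure μ] (hN : IsPoissonFor P.lam μ ℱ N)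
    (σ : Ω → ℝ≥0) : 0 ≤ P.lostTime μ N σ :=
  intervalIntegral.integral_nonneg P.deadline_pos.le fun _ hu =>
    mul_nonneg (Real.exp_pos _).le (sub_nonneg.2 (occ_le_prob hN σ one_le_two hu.1))

/-- A schedule that loses no time in stage `1` never stops before completion. -/
lemma ae_completion_le_of_lostTime_nonpos [IsProbabilityMeasure μ]
    (hN : IsPoissonFor P.lam μ ℱ N) {σ : Ω → ℝ≥0} (hσ : P.IsSchedule ℱ σ)
    (h : P.lostTime μ N σ ≤ 0) :
    ∀ᵐ ω ∂μ, min (completion N ω) (P.T : WithTop ℝ≥0) ≤ (σ ω : WithTop ℝ≥0) := by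
  have hT := P.deadline_pos
  obtain ⟨τ, hτ⟩ := exists_isCutoff hN 0 P.T
  have hone : ∀ᵐ u ∂volume, u ∈ Set.Ioo (0 : ℝ) P.T →
      Real.exp (-P.r * u) * (P.prob 1 u - occ μ N σ 1 u) = 0 :=
    ae_eq_zero_of_integral_nonpos hT.le
      (intervalIntegrable_lost hN hσ P.continuous_discount 1 _ _) (fun u hu _ =>
        mul_nonneg (Real.exp_pos _).le (sub_nonneg.2 (occ_le_prob hN σ one_le_two hu))) h
  have c0 : Continuous fun u => P.lam * (Real.exp (-P.r * u) * P.horizon u) :=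
    continuous_const.mul P.continuous_discount_mul_horizon
  -- Comparing `integral_occ_one` for `σ` and for stopping at completion, the lost time in stage 1
  -- is this integral plus `forgone`. Since `forgone` is nonnegative, no stage-0 time is lost
  -- either.
  have hlost : ∫ u in (0 : ℝ)..P.T, P.lam * (Real.exp (-P.r * u) * P.horizon u) *
      (P.prob 0 u - occ μ N σ 0 u) ≤ 0 := by
    have e1 := integral_occ_one hN hσ
    have e2 := integral_occ_one hN hτ.schedule
    rw [hτ.forgone_eq_zero, sub_zero] at e2
    have hp : ∀ {φ : ℝ → ℝ} {i : ℕ}, i ≤ 1 → ∫ u in (0 : ℝ)..P.T, φ u * occ μ N τ i u =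
        ∫ u in (0 : ℝ)..P.T, φ u * P.prob i u := by
      intro φ i hi
      refine intervalIntegral.integral_congr_ae ?_
      filter_upwards [Measure.ae_ne volume (P.T : ℝ)] with u hne hu
      rw [Set.uIoc_of_le hT.le] at hu
      rw [hτ.occ_of_lt hN le_rfl (by omega) hu.1.le (lt_of_le_of_ne hu.2 hne) (by omega)]
    rw [hp le_rfl, hp zero_le_one] at e2
    have hQ := forgone_nonneg (μ := μ) (N := N) hσ
    have hl : P.lostTime μ N σ = (∫ u in (0 : ℝ)..P.T, Real.exp (-P.r * u) * P.prob 1 u) -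
        ∫ u in (0 : ℝ)..P.T, Real.exp (-P.r * u) * occ μ N σ 1 u := by
      rw [← intervalIntegral.integral_sub (P.intervalIntegrable_mul_prob
        P.continuous_discount 1 _ _)
        (intervalIntegrable_occ hN hσ P.continuous_discount 1 _ _)]
      simp only [lostTime, mul_sub]
    simp only [mul_sub]
    rw [intervalIntegral.integral_sub (P.intervalIntegrable_mul_prob c0 0 _ _)
      (intervalIntegrable_occ hN hσ c0 0 _ _)]
    linarith
  have hzero := ae_eq_zero_of_integral_nonpos hT.le
    (intervalIntegrable_lost hN hσ c0 0 _ _) (fun u hu huT =>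
      mul_nonneg (mul_nonneg P.lam_coe_pos.le (mul_nonneg (Real.exp_pos _).le (P.horizon_nonneg huT)))
        (sub_nonneg.2 (occ_le_prob hN σ zero_le_two hu))) hlost
  have hs : ∀ i ≤ 1, ∀ᵐ ω ∂μ, σ ω < P.T → stage N (σ ω) ω ≠ i := by
    intro i hi
    refine ae_stage_ne_of_stopped_null hN hσ ?_
    filter_upwards [hone, hzero] with u h1 h0 hu
    have hsum := occ_add_stopped hN hσ (i := i) (by omega) hu.1.le
    have heq : P.prob i u - occ μ N σ i u = 0 := by
      interval_cases i
      · refine (mul_eq_zero.1 (h0 hu)).resolve_left (ne_of_gt ?_)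
        exact mul_pos P.lam_coe_pos (mul_pos (Real.exp_pos _) (P.horizon_pos hu.2))
      · exact (mul_eq_zero.1 (h1 hu)).resolve_left (Real.exp_pos _).ne'
    linarith
  filter_upwards [hs 0 zero_le_one, hs 1 le_rfl] with ω h0 h1
  by_cases hlt : σ ω < P.T
  · have h2 : stage N (σ ω) ω = 2 := by
      have := stage_le_two (N := N) (σ ω) ω
      have := h0 hlt
      have := h1 hlt
      omega
    exact (min_le_left _ _).trans (hittingAfter_le_of_mem zero_le h2)
  · exact (min_le_right _ _).trans (WithTop.coe_le_coe.2 (not_lt.1 hlt))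

end Thresholds

/-! ### Full-information profitability and the low-cost case -/

section LowCost

variable {Ω : Type*} {m : MeasurableSpace Ω} {μ : Measure Ω} {ℱ : Filtration ℝ≥0 m}
  {N : ℝ≥0 → Ω → ℕ} {P : Project}

/-- The weight of date `u` in the value of a flow attributed to stage `0`. -/
noncomputable def weight (P : Project) (g₀ g₁ u : ℝ) : ℝ := g₀ + P.lam * g₁ * P.horizon u

lemma continuous_weight (P : Project) (g₀ g₁ : ℝ) : Continuous (P.weight g₀ g₁) :=
  continuous_const.add (continuous_const.mul P.continuous_horizon)

/-- A first success at a later date leaves less time for stage 1. This monotonicity is what makes an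
interim deadline for stage 0 the right form of stopping. -/
lemma weight_strictAnti (P : Project) (g₀ : ℝ) {g₁ : ℝ} (hg : 0 < g₁) :
    StrictAnti (P.weight g₀ g₁) := by
  intro a b hab
  have := P.horizon_strictAnti hab
  have hl := P.lam_coe_pos
  simp only [weight]
  gcongr

/-- The principal's payoff from investing with interim deadline `S`. -/
noncomputable def interimValue (P : Project) (S : ℝ) : ℝ :=
  ∫ u in (0 : ℝ)..S, Real.exp (-P.r * u) * P.weight (-P.c) P.gain u * P.prob 0 u

lemma continuous_interim_integrand (P : Project) (g₀ g₁ : ℝ) :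
    Continuous fun u => Real.exp (-P.r * u) * P.weight g₀ g₁ u * P.prob 0 u :=
  (P.continuous_discount.mul (P.continuous_weight _ _)).mul (P.continuous_prob 0)

lemma continuous_interimValue (P : Project) : Continuous P.interimValue :=
  intervalIntegral.continuous_primitive
    (fun a b => (P.continuous_interim_integrand _ _).intervalIntegrable a b) 0

lemma interimValue_pos (P : Project) (hg : 0 < P.gain) {S : ℝ} (hS : 0 < S)
    (h : 0 ≤ P.weight (-P.c) P.gain S) : 0 < P.interimValue S := by
  refine intervalIntegral.intervalIntegral_pos_of_pos_on
    ((P.continuous_interim_integrand _ _).intervalIntegrable _ _) (fun u hu => ?_) hS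
  have h1 := P.weight_strictAnti (-P.c) hg hu.2
  exact mul_pos (mul_pos (Real.exp_pos _) (h.trans_lt h1)) (P.prob_zero_pos u)

lemma gain_pos_of_weight_pos (P : Project) (h : 0 < P.weight (-P.c) P.gain 0) : 0 < P.gain := by
  have h1 := P.horizon_pos P.deadline_pos
  have h2 := P.lam_coe_pos
  have h3 := P.c_pos
  simp only [weight] at h
  by_contra hn
  have : P.lam * P.gain * P.horizon 0 ≤ 0 :=
    mul_nonpos_of_nonpos_of_nonneg (mul_nonpos_of_nonneg_of_nonpos h2.le (not_lt.1 hn)) h1.le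
  linarith

lemma exists_interimValue_pos (P : Project) (h : 0 < P.weight (-P.c) P.gain 0) :
    ∃ S : ℝ≥0, 0 < S ∧ S < P.T ∧ 0 < P.interimValue S := by
  have h1 : ∀ᶠ s in nhdsWithin (0 : ℝ) (Set.Ioi 0), 0 < P.weight (-P.c) P.gain s :=
    (((P.continuous_weight _ _).tendsto 0).eventually (lt_mem_nhds h)).filter_mono
      nhdsWithin_le_nhds
  obtain ⟨s, hs, hs0, hsT⟩ := (h1.and (Ioo_mem_nhdsGT P.deadline_pos)).exists
  lift s to ℝ≥0 using hs0.le
  exact ⟨s, by exact_mod_cast hs0, by exact_mod_cast hsT,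
    P.interimValue_pos (P.gain_pos_of_weight_pos h) hs0 hs.le⟩

lemma IsCutoff.integral_net_eq [IsProbabilityMeasure μ] (hN : IsPoissonFor P.lam μ ℱ N)
    {S : ℝ≥0} {τ : Ω → ℝ≥0} (h : P.IsCutoff ℱ N 0 S τ) (hS : S ≤ P.T) :
    ∫ u in (0 : ℝ)..P.T, P.net μ N τ u = P.interimValue S :=
  h.integral_flow_eq hN hS _ _ _

lemma integral_discount_occ_nonneg (P : Project) (σ : Ω → ℝ≥0) (i : ℕ) :
    0 ≤ ∫ u in (0 : ℝ)..P.T, Real.exp (-P.r * u) * occ μ N σ i u :=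
  intervalIntegral.integral_nonneg P.deadline_pos.le fun u _ =>
    mul_nonneg (Real.exp_pos _).le (occ_nonneg σ i u)

lemma intervalIntegrable_weight [IsProbabilityMeasure μ] (hN : IsPoissonFor P.lam μ ℱ N)
    {σ : Ω → ℝ≥0} (hσ : P.IsSchedule ℱ σ) (g₀ g₁ a b : ℝ) :
    IntervalIntegrable (fun u => Real.exp (-P.r * u) * P.weight g₀ g₁ u * occ μ N σ 0 u)
      volume a b :=
  intervalIntegrable_occ hN hσ (P.continuous_discount.mul (P.continuous_weight g₀ g₁)) 0 a b

/-- With positive `gain`, the payoff is at most the integral of the weight over stage 0, and the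
weight is largest at date 0. Conversely, a short enough interim deadline earns a positive amount. -/
lemma fullInfoProfitable_iff [IsProbabilityMeasure μ] (hN : IsPoissonFor P.lam μ ℱ N) :
    P.FullInfoProfitable μ ℱ N ↔ 0 < P.weight (-P.c) P.gain 0 := by
  constructor
  · rintro ⟨σ, hσ, hpos⟩
    by_contra hn
    rw [principalPayoff_eq hN hσ] at hpos
    refine absurd hpos (not_lt.2 ?_)
    -- Without positive `gain` the weight need not decrease, but then every flow of the principal is
    -- nonpositive.
    rcases le_or_gt P.gain 0 with hg | hg
    · rw [← neg_nonneg, ← intervalIntegral.integral_neg]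
      refine intervalIntegral.integral_nonneg P.deadline_pos.le fun u _ => ?_
      have h0 := mul_nonneg P.c_pos.le (occ_nonneg (μ := μ) (N := N) σ 0 u)
      have h1 := mul_nonneg (neg_nonneg.2 hg) (occ_nonneg (μ := μ) (N := N) σ 1 u)
      have h2 := mul_nonneg P.delayCost_pos.le (occ_nonneg (μ := μ) (N := N) σ 2 u)
      rw [net, flow, ← mul_neg]
      exact mul_nonneg (Real.exp_pos _).le (by linarith)
    · have h := integral_flow hN hσ (-P.c) P.gain (-P.delayCost)
      have h2 := mul_nonneg P.delayCost_pos.le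
        (integral_discount_occ_nonneg (μ := μ) (N := N) P σ 2)
      have h1 := mul_nonneg hg.le (forgone_nonneg (μ := μ) (N := N) hσ)
      have h0 : ∫ u in (0 : ℝ)..P.T,
          Real.exp (-P.r * u) * P.weight (-P.c) P.gain u * occ μ N σ 0 u ≤ 0 := by
        rw [← neg_nonneg, ← intervalIntegral.integral_neg]
        refine intervalIntegral.integral_nonneg P.deadline_pos.le fun u hu => ?_
        have h3 := (P.weight_strictAnti (-P.c) hg).antitone hu.1
        have h4 : 0 ≤ -P.weight (-P.c) P.gain u := by linarith
        have h5 := mul_nonneg (mul_nonneg (Real.exp_pos (-P.r * u)).le h4)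
          (occ_nonneg (μ := μ) (N := N) σ 0 u)
        linarith
      simp only [weight] at h0
      simp only [net]
      rw [h]
      linarith
  · intro h
    obtain ⟨S, _, hST, hS⟩ := P.exists_interimValue_pos h
    obtain ⟨τ, hτ⟩ := exists_isCutoff hN 0 S
    exact ⟨τ, hτ.schedule, by
      rwa [principalPayoff_eq hN hτ.schedule, hτ.integral_net_eq hN hST.le]⟩

/-- If investing until completion or the deadline is profitable, it is rational at all dates. -/
lemma integral_baseFlow_nonneg [IsProbabilityMeasure μ] (hN : IsPoissonFor P.lam μ ℱ N)
    (hg : 0 < P.gain) (h : 0 ≤ ∫ u in (0 : ℝ)..P.T, P.baseFlow u) {t : ℝ} (ht0 : 0 ≤ t)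
    (htT : t ≤ P.T) : 0 ≤ ∫ u in t..P.T, P.baseFlow u := by
  obtain ⟨τ, hτ⟩ := exists_isCutoff hN 0 P.T
  have hnet : ∀ t : ℝ, 0 ≤ t → t ≤ P.T →
      ∫ u in t..P.T, P.net μ N τ u = ∫ u in t..P.T, P.baseFlow u := fun t h0 hT =>
    hτ.integral_net_of_ge hN (by simpa using h0) hT
  have hf := hτ.isFeasible hN le_rfl hg (by rwa [hnet 0 le_rfl P.deadline_pos.le])
  rw [← hnet t ht0 htT]
  exact (isFeasible_iff hN hτ.schedule).1 hf t ht0 htT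

/-- There is a date `S` until which completed projects can be delayed such that the rationality
constraint binds at some date `t ≤ S` and holds at all dates. -/
lemma exists_delay [IsProbabilityMeasure μ] (hN : IsPoissonFor P.lam μ ℱ N)
    (hg : 0 < P.gain) (h : 0 ≤ ∫ u in (0 : ℝ)..P.T, P.baseFlow u) :
    ∃ S : ℝ≥0, S ≤ P.T ∧ ∃ t : ℝ, 0 ≤ t ∧ t ≤ S ∧ ∀ τ, P.IsCutoff ℱ N S P.T τ →
      P.IsFeasible μ ℱ N τ ∧ ∫ u in t..P.T, P.net μ N τ u = 0 := by
  set q : ℝ → ℝ := fun u => P.delayCost * (Real.exp (-P.r * u) * P.prob 2 u) with hq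
  have hqc : Continuous q :=
    continuous_const.mul (P.continuous_discount.mul (P.continuous_prob 2))
  have hbi := fun a b => P.continuous_baseFlow.intervalIntegrable (μ := volume) a b
  have hqi := fun a b => hqc.intervalIntegrable (μ := volume) a b
  set A : ℝ → ℝ := fun t => ∫ u in (0 : ℝ)..t, P.baseFlow u with hA
  set B : ℝ → ℝ := fun t => ∫ u in (0 : ℝ)..t, q u with hB
  have hAc : Continuous A := intervalIntegral.continuous_primitive hbi 0
  have hBc : Continuous B := intervalIntegral.continuous_primitive hqi 0
  have hT := P.deadline_pos
  -- With delay up to `S`, the value from `s ≤ S` is `A T - A s - (B S - B s)`. It is smallest where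
  -- `A - B` is largest, so the constraint can first bind at this `t`.
  obtain ⟨t, ht, hmax⟩ := (isCompact_Icc (a := (0 : ℝ)) (b := P.T)).exists_isMaxOn
    ⟨0, le_rfl, hT.le⟩ (hAc.sub hBc).continuousOn
  have hAs : ∀ s, ∫ u in s..P.T, P.baseFlow u = A P.T - A s := fun s => by
    rw [hA, eq_sub_iff_add_eq, add_comm]
    exact intervalIntegral.integral_add_adjacent_intervals (hbi _ _) (hbi _ _)
  have hBs : ∀ s s', ∫ u in s..s', q u = B s' - B s := fun s s' => by
    rw [hB, eq_sub_iff_add_eq, add_comm]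
    exact intervalIntegral.integral_add_adjacent_intervals (hqi _ _) (hqi _ _)
  have hRt := integral_baseFlow_nonneg hN hg h ht.1 ht.2
  rw [hAs] at hRt
  have hmaxT : A P.T - B P.T ≤ A t - B t := hmax ⟨hT.le, le_rfl⟩
  -- `S` makes the value from `t` zero. The target is at least `B t` because the base value from `t`
  -- is nonnegative, and at most `B T` because `t` maximizes `A - B`.
  obtain ⟨S, hS, hSeq⟩ := intermediate_value_Icc ht.2 hBc.continuousOn
    (show A P.T - (A t - B t) ∈ Set.Icc (B t) (B P.T) by constructor <;> linarith)
  have hS0 : 0 ≤ S := ht.1.trans hS.1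
  lift S to ℝ≥0 using hS0
  have hST : S ≤ P.T := by exact_mod_cast hS.2
  refine ⟨S, hST, t, ht.1, hS.1, fun τ hτ => ⟨?_, ?_⟩⟩
  · rw [isFeasible_iff hN hτ.schedule]
    intro s hs0 hsT
    rcases le_total s S with hs | hs
    · rw [hτ.integral_net_of_le hN hST hs0 hs, hAs, hBs]
      have : A s - B s ≤ A t - B t := hmax ⟨hs0, hsT⟩
      linarith
    · rw [hτ.integral_net_of_ge hN hs hsT]
      exact integral_baseFlow_nonneg hN hg h hs0 hsT
  · rw [hτ.integral_net_of_le hN hST ht.1 hS.1, hAs, hBs]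
    linarith

/-- If investing until completion or the deadline is profitable, some feasible schedule is better
for the agent than any other, by at least the value of the time in stage `1` that is lost. -/
lemma exists_feasible_dominating [IsProbabilityMeasure μ] (hN : IsPoissonFor P.lam μ ℱ N)
    (hg : 0 < P.gain) (h : 0 ≤ ∫ u in (0 : ℝ)..P.T, P.baseFlow u) :
    ∃ τ, P.IsFeasible μ ℱ N τ ∧ ∀ σ, P.IsFeasible μ ℱ N σ →
      P.agentPayoff μ N σ + P.agentGain * P.lostTime μ N σ ≤ P.agentPayoff μ N τ := by
  have hT := P.deadline_pos
  have hβc := mul_nonneg P.β_nonneg P.c_pos.le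
  rcases le_or_gt P.agentDelay 0 with hw | hw
  · obtain ⟨τ, hτ⟩ := exists_isCutoff hN 0 P.T
    refine ⟨τ, hτ.isFeasible hN le_rfl hg ?_, fun σ hσ => ?_⟩
    · rwa [hτ.integral_net_of_ge hN (by simp) hT.le]
    rw [agentPayoff_eq hN hσ.schedule, agentPayoff_eq hN hτ.schedule, lostTime,
      ← intervalIntegral.integral_const_mul, ← intervalIntegral.integral_add
      (intervalIntegrable_flow hN hσ.schedule _ _ _ _ _)
      ((intervalIntegrable_lost hN hσ.schedule P.continuous_discount 1 _ _).const_mul _)]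
    refine intervalIntegral.integral_mono_on_of_le_Ioo hT.le
      ((intervalIntegrable_flow hN hσ.schedule _ _ _ _ _).add
      ((intervalIntegrable_lost hN hσ.schedule P.continuous_discount 1 _ _).const_mul _))
      (intervalIntegrable_flow hN hτ.schedule _ _ _ _ _) fun u hu => ?_
    rw [hτ.flow_eq hN _ _ _ hu.1.le hu.2, if_neg (by simpa using hu.1.le), flow]
    have h0 := mul_le_mul_of_nonneg_left (occ_le_prob hN σ zero_le_two hu.1.le) hβc
    have h2 := mul_nonneg (neg_nonneg.2 hw) (occ_nonneg (μ := μ) (N := N) σ 2 u)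
    have : Real.exp (-P.r * u) * (P.β * P.c * occ μ N σ 0 u + P.agentGain * P.prob 1 u +
        P.agentDelay * occ μ N σ 2 u) ≤ Real.exp (-P.r * u) *
        (P.β * P.c * P.prob 0 u + P.agentGain * P.prob 1 u + P.agentDelay * 0) := by
      gcongr ?_ * ?_
      linarith
    linarith
  · obtain ⟨S, hST, t, ht0, htS, hS⟩ := exists_delay hN hg h
    obtain ⟨τ, hτ⟩ := exists_isCutoff hN S P.T
    obtain ⟨hfeas, hbind⟩ := hS τ hτ
    have htT : t ≤ P.T := htS.trans (by exact_mod_cast hST)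
    refine ⟨τ, hfeas, fun σ hσ => ?_⟩
    have hX := (isFeasible_iff hN hσ.schedule).1 hσ t ht0 htT
    have hd := P.delayCost_pos
    -- This multiplier on the constraint at `t` cancels the stage-2 flow in the Lagrangian. The
    -- stage-0 coefficient becomes `(β - ν) * c`, whence the need for `ν ≤ β`.
    set ν := P.agentDelay / P.delayCost with hν
    have hν0 : 0 < ν := div_pos hw hd
    have hνd : ν * P.delayCost = P.agentDelay := div_mul_cancel₀ _ hd.ne'
    have hνβ : ν ≤ P.β := by
      rw [hν, div_le_iff₀ hd]
      have h1 : 0 ≤ P.r * (P.α * P.v) :=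
        mul_nonneg P.r_pos.le (mul_nonneg P.α_pos.le P.v_pos.le)
      have h2 : 0 ≤ P.r * ((1 - P.α) * P.v) :=
        mul_nonneg P.r_pos.le (mul_nonneg (by linarith [P.α_le_one]) P.v_pos.le)
      have h3 := mul_nonneg P.β_nonneg h1
      simp only [agentDelay, delayCost]
      linarith
    have hf := fun {ρ : Ω → ℝ≥0} (hρ : P.IsSchedule ℱ ρ) a b =>
      intervalIntegrable_flow hN hρ (P.β * P.c) P.agentGain P.agentDelay a b
    have hn : ∀ {ρ : Ω → ℝ≥0}, P.IsSchedule ℱ ρ → ∀ a b,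
        IntervalIntegrable (fun u => ν * P.net μ N ρ u) volume a b := fun hρ a b =>
      (intervalIntegrable_flow hN hρ (-P.c) P.gain (-P.delayCost) a b).const_mul ν
    have hl := fun a b => (intervalIntegrable_lost hN hσ.schedule P.continuous_discount 1 a
      b).const_mul P.agentGain
    have hsum : ∀ a b, IntervalIntegrable (fun u => P.flow μ N σ (P.β * P.c) P.agentGain
        P.agentDelay u + P.agentGain * (Real.exp (-P.r * u) * (P.prob 1 u - occ μ N σ 1 u)))
        volume a b := fun a b => (hf hσ.schedule a b).add (hl a b)
    -- Before `t` the schedule `τ` never stops, and all flows of the agent are nonnegative.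
    have hearly : ∫ u in (0 : ℝ)..t, (P.flow μ N σ (P.β * P.c) P.agentGain P.agentDelay u +
        P.agentGain * (Real.exp (-P.r * u) * (P.prob 1 u - occ μ N σ 1 u))) ≤
        ∫ u in (0 : ℝ)..t, P.flow μ N τ (P.β * P.c) P.agentGain P.agentDelay u := by
      refine intervalIntegral.integral_mono_on_of_le_Ioo ht0 (hsum _ _) (hf hτ.schedule _ _)
        fun u hu => ?_
      rw [hτ.flow_eq hN _ _ _ hu.1.le (hu.2.trans_le htT), if_pos (hu.2.trans_le htS), flow]
      have h0 := mul_le_mul_of_nonneg_left (occ_le_prob hN σ zero_le_two hu.1.le) hβc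
      have h2 := mul_le_mul_of_nonneg_left (occ_le_prob hN σ le_rfl hu.1.le) hw.le
      have : Real.exp (-P.r * u) * (P.β * P.c * occ μ N σ 0 u + P.agentGain * P.prob 1 u +
          P.agentDelay * occ μ N σ 2 u) ≤ Real.exp (-P.r * u) *
          (P.β * P.c * P.prob 0 u + P.agentGain * P.prob 1 u + P.agentDelay * P.prob 2 u) := by
        gcongr ?_ * ?_
        linarith
      linarith
    -- After `t` the stage-2 occupation no longer matters, and `τ` attains the largest possible
    -- occupation of stages 0 and 1.
    have hlate : ∫ u in t..P.T, ((P.flow μ N σ (P.β * P.c) P.agentGain P.agentDelay u +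
        P.agentGain * (Real.exp (-P.r * u) * (P.prob 1 u - occ μ N σ 1 u))) +
        ν * P.net μ N σ u) ≤
        ∫ u in t..P.T, (P.flow μ N τ (P.β * P.c) P.agentGain P.agentDelay u +
          ν * P.net μ N τ u) := by
      refine intervalIntegral.integral_mono_on_of_le_Ioo htT
        ((hsum _ _).add (hn hσ.schedule _ _))
        ((hf hτ.schedule _ _).add (hn hτ.schedule _ _)) fun u hu => ?_
      have hu0 := ht0.trans hu.1.le
      rw [net, net, hτ.flow_eq hN _ _ _ hu0 hu.2, hτ.flow_eq hN _ _ _ hu0 hu.2, flow, flow,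
        ← hνd]
      have h0 := mul_le_mul_of_nonneg_left (occ_le_prob hN σ zero_le_two hu0)
        (mul_nonneg (sub_nonneg.2 hνβ) P.c_pos.le)
      have h1 := mul_le_mul_of_nonneg_left (occ_le_prob hN σ one_le_two hu0)
        (mul_nonneg hν0.le hg.le)
      have : Real.exp (-P.r * u) * ((P.β - ν) * P.c * occ μ N σ 0 u + ν * P.gain * occ μ N σ 1 u
          + P.agentGain * P.prob 1 u) ≤ Real.exp (-P.r * u) *
          ((P.β - ν) * P.c * P.prob 0 u + ν * P.gain * P.prob 1 u
          + P.agentGain * P.prob 1 u) := by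
        gcongr ?_ * ?_
        linarith
      linarith
    rw [intervalIntegral.integral_add (hsum _ _) (hn hσ.schedule _ _),
      intervalIntegral.integral_add (hf hτ.schedule _ _) (hn hτ.schedule _ _),
      intervalIntegral.integral_const_mul, intervalIntegral.integral_const_mul, hbind] at hlate
    have hνX := mul_nonneg hν0.le hX
    rw [agentPayoff_eq hN hσ.schedule, agentPayoff_eq hN hτ.schedule, lostTime,
      ← intervalIntegral.integral_const_mul, ← intervalIntegral.integral_add (hf hσ.schedule _ _)
      (hl _ _), ← intervalIntegral.integral_add_adjacent_intervals (hsum 0 t) (hsum t P.T),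
      ← intervalIntegral.integral_add_adjacent_intervals (hf hτ.schedule 0 t)
      (hf hτ.schedule t P.T)]
    linarith

/-- With a low cost-benefit ratio, the optimal schedules stop only after completion. -/
theorem optimal_of_le_noInterimCutoff [IsProbabilityMeasure μ] (hN : IsPoissonFor P.lam μ ℱ N)
    (hP : ¬ (P.α = 1 ∧ P.β = 0)) (h : P.κ ≤ noInterimCutoff P.T P.lam P.r P.α) :
    (∃ τ, P.IsOptimal μ ℱ N τ) ∧ ∀ τ, P.IsOptimal μ ℱ N τ →
      ∀ᵐ ω ∂μ, min (completion N ω) (P.T : WithTop ℝ≥0) ≤ (τ ω : WithTop ℝ≥0) := by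
  have hg : 0 < P.gain :=
    P.gain_pos_of_weight_pos ((κ_lt_fullInfoCutoff_iff P).1
      (h.trans_lt P.noInterimCutoff_lt_fullInfoCutoff))
  rw [κ_le_noInterimCutoff_iff, ← integral_baseFlow] at h
  obtain ⟨τ, hτ, hdom⟩ := exists_feasible_dominating hN hg h
  have hw := P.agentGain_pos hP
  refine ⟨⟨τ, hτ, fun σ hσ => ?_⟩, fun σ hσ => ?_⟩
  · have := mul_nonneg hw.le (lostTime_nonneg hN σ)
    linarith [hdom σ hσ]
  · refine ae_completion_le_of_lostTime_nonpos hN hσ.feasible.schedule ?_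
    have h1 := hdom σ hσ.feasible
    have h2 := hσ.maximal τ hτ
    exact nonpos_of_mul_nonpos_right (by linarith) hw

end LowCost

/-! ### The interim deadline in the intermediate-cost case -/

section IntermediateCost

variable {Ω : Type*} {m : MeasurableSpace Ω} {μ : Measure Ω} {ℱ : Filtration ℝ≥0 m}
  {N : ℝ≥0 → Ω → ℕ} {P : Project}

lemma interimValue_deadline [IsProbabilityMeasure μ] (hN : IsPoissonFor P.lam μ ℱ N) :
    P.interimValue P.T = ∫ u in (0 : ℝ)..P.T, P.baseFlow u := by
  obtain ⟨τ, hτ⟩ := exists_isCutoff hN 0 P.T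
  rw [← hτ.integral_net_eq hN le_rfl, hτ.integral_net_of_ge hN (by simp) P.deadline_pos.le]

/-- The interim deadline at which the principal breaks even. -/
lemma exists_interimValue_eq_zero [IsProbabilityMeasure μ] (hN : IsPoissonFor P.lam μ ℱ N)
    (h0 : 0 < P.weight (-P.c) P.gain 0) (hneg : ∫ u in (0 : ℝ)..P.T, P.baseFlow u < 0) :
    ∃ S : ℝ≥0, 0 < S ∧ S < P.T ∧ P.interimValue S = 0 ∧ P.weight (-P.c) P.gain S < 0 := by
  obtain ⟨s, hs0, hsT, hs⟩ := P.exists_interimValue_pos h0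
  rw [← interimValue_deadline hN] at hneg
  obtain ⟨S, hS, hS0⟩ := intermediate_value_Icc' (a := (s : ℝ)) (b := P.T)
    (by exact_mod_cast hsT.le) P.continuous_interimValue.continuousOn
    (show (0 : ℝ) ∈ Set.Icc _ _ from ⟨hneg.le, hs.le⟩)
  have hSpos : 0 < S := lt_of_lt_of_le (by exact_mod_cast hs0) hS.1
  lift S to ℝ≥0 using hSpos.le
  have hST : S ≠ P.T := fun h => hneg.ne (h ▸ hS0)
  refine ⟨S, by exact_mod_cast hSpos, lt_of_le_of_ne (by exact_mod_cast hS.2) hST, hS0, ?_⟩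
  -- A nonnegative weight at `S` would mean a positive weight throughout `[0, S)`, hence a positive
  -- value.
  by_contra hn
  exact (P.interimValue_pos (P.gain_pos_of_weight_pos h0) hSpos (not_lt.1 hn)).ne' hS0

/-- The multiplier of the principal's rationality constraint at date `0`. -/
lemma exists_multiplier (P : Project) (hP : ¬ (P.α = 1 ∧ P.β = 0)) (hg : 0 < P.gain) {S : ℝ≥0}
    (hST : S < P.T) (hS : P.weight (-P.c) P.gain S < 0) :
    ∃ ν : ℝ, 0 < ν ∧ P.agentDelay - ν * P.delayCost < 0 ∧
      P.weight (P.β * P.c - ν * P.c) (P.agentGain + ν * P.gain) S = 0 := by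
  have hw := P.agentGain_pos hP
  have hl := P.lam_coe_pos
  have hc := P.c_pos
  have he : 0 < P.horizon S := P.horizon_pos (by exact_mod_cast hST)
  have hβ := P.β_nonneg
  simp only [weight] at hS ⊢
  have hden : 0 < P.c - P.lam * P.gain * P.horizon S := by linarith
  have hnum : 0 < P.β * P.c + P.lam * P.agentGain * P.horizon S := by positivity
  -- The solution of the linear equation for a zero Lagrangian weight at `S`; its denominator is
  -- minus the principal's weight there.
  refine ⟨(P.β * P.c + P.lam * P.agentGain * P.horizon S) /
    (P.c - P.lam * P.gain * P.horizon S), div_pos hnum hden, ?_, ?_⟩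
  · set ν := (P.β * P.c + P.lam * P.agentGain * P.horizon S) /
      (P.c - P.lam * P.gain * P.horizon S) with hν
    have hν0 : 0 < ν := div_pos hnum hden
    have hmul : ν * (P.c - P.lam * P.gain * P.horizon S) =
        P.β * P.c + P.lam * P.agentGain * P.horizon S := div_mul_cancel₀ _ hden.ne'
    have h1 : 0 < P.lam * P.agentGain * P.horizon S := by positivity
    have h2 : 0 < ν * (P.lam * P.gain * P.horizon S) := by positivity
    have h3 : 0 ≤ P.r * ((1 - P.α) * P.v) :=
      mul_nonneg P.r_pos.le (mul_nonneg (by linarith [P.α_le_one]) P.v_pos.le)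
    have h4 : 0 ≤ ν * (P.r * (P.α * P.v)) :=
      mul_nonneg hν0.le (mul_nonneg P.r_pos.le (mul_nonneg P.α_pos.le P.v_pos.le))
    -- The equation for `ν` gives `ν * c > β * c`, and the discounting terms only lower the stage-2
    -- flow further.
    simp only [agentDelay, delayCost]
    linarith
  · have hmul := div_mul_cancel₀ (P.β * P.c + P.lam * P.agentGain * P.horizon S) hden.ne'
    linarith

/-- The loss of a schedule `σ`, relative to the interim deadline `S`, in the Lagrangian with
flow `gᵢ` in stage `i`. -/
noncomputable def lagrangianGap (P : Project) {m : MeasurableSpace Ω} (μ : Measure Ω)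
    (N : ℝ≥0 → Ω → ℕ) (σ : Ω → ℝ≥0) (S : ℝ≥0) (g₀ g₁ g₂ : ℝ) : ℝ :=
  (∫ u in (0 : ℝ)..S, Real.exp (-P.r * u) * P.weight g₀ g₁ u *
      (P.prob 0 u - occ μ N σ 0 u)) +
    (∫ u in (S : ℝ)..P.T, Real.exp (-P.r * u) * (-P.weight g₀ g₁ u) * occ μ N σ 0 u) +
    (-g₂) * (∫ u in (0 : ℝ)..P.T, Real.exp (-P.r * u) * occ μ N σ 2 u) +
    g₁ * P.forgone μ N σ

/-- The interim-deadline schedule spends no time in stage 2 and forgoes nothing, so only its stage-0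
integral up to `S` remains. For `σ` the stage-0 integral is split at `S`, where the weight will
change sign. -/
lemma integral_flow_sub_eq_lagrangianGap [IsProbabilityMeasure μ] (hN : IsPoissonFor P.lam μ ℱ N)
    {σ τ : Ω → ℝ≥0} (hσ : P.IsSchedule ℱ σ) {S : ℝ≥0} (hτ : P.IsCutoff ℱ N 0 S τ)
    (hST : S ≤ P.T) (g₀ g₁ g₂ : ℝ) :
    (∫ u in (0 : ℝ)..P.T, P.flow μ N τ g₀ g₁ g₂ u) -
      ∫ u in (0 : ℝ)..P.T, P.flow μ N σ g₀ g₁ g₂ u =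
    P.lagrangianGap μ N σ S g₀ g₁ g₂ := by
  have hw := intervalIntegrable_weight hN hσ g₀ g₁
  rw [hτ.integral_flow_eq hN hST, integral_flow hN hσ]
  have e1 : ∫ u in (0 : ℝ)..S, Real.exp (-P.r * u) * P.weight g₀ g₁ u *
      (P.prob 0 u - occ μ N σ 0 u) =
      (∫ u in (0 : ℝ)..S, Real.exp (-P.r * u) * P.weight g₀ g₁ u * P.prob 0 u) -
      ∫ u in (0 : ℝ)..S, Real.exp (-P.r * u) * P.weight g₀ g₁ u * occ μ N σ 0 u := by
    rw [← intervalIntegral.integral_sub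
      ((P.continuous_interim_integrand g₀ g₁).intervalIntegrable _ _) (hw _ _)]
    simp only [mul_sub]
  have e2 : ∫ u in (S : ℝ)..P.T, Real.exp (-P.r * u) * (-P.weight g₀ g₁ u) * occ μ N σ 0 u =
      -∫ u in (S : ℝ)..P.T, Real.exp (-P.r * u) * P.weight g₀ g₁ u * occ μ N σ 0 u := by
    rw [← intervalIntegral.integral_neg]
    refine intervalIntegral.integral_congr fun u _ => ?_
    ring
  have e3 := intervalIntegral.integral_add_adjacent_intervals (hw 0 S) (hw S P.T)
  rw [lagrangianGap, e1, e2]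
  simp only [weight] at e3 ⊢
  linarith

/-- A schedule that maximizes the Lagrangian stops at `S` if no stage has been completed by then,
and upon completion if both stages have been completed by then. -/
lemma ae_of_lagrangianGap_nonpos [IsProbabilityMeasure μ] (hN : IsPoissonFor P.lam μ ℱ N)
    {σ : Ω → ℝ≥0} (hσ : P.IsSchedule ℱ σ) {S : ℝ≥0} (hST : S < P.T) {g₀ g₁ g₂ : ℝ}
    (hg₁ : 0 < g₁) (hg₂ : g₂ < 0) (hw : P.weight g₀ g₁ S = 0)
    (hgap : P.lagrangianGap μ N σ S g₀ g₁ g₂ ≤ 0) :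
    ∀ᵐ ω ∂μ, (stage N S ω = 0 → σ ω = S) ∧
      (stage N S ω = 2 → σ ω < P.T ∧ stage N (σ ω) ω = 2) := by
  rw [lagrangianGap] at hgap
  have hT := P.deadline_pos
  have hS0 : (0 : ℝ) ≤ S := NNReal.coe_nonneg _
  have hST' : (S : ℝ) ≤ P.T := by exact_mod_cast hST.le
  have hanti := P.weight_strictAnti g₀ hg₁
  have hcw : Continuous fun u => Real.exp (-P.r * u) * P.weight g₀ g₁ u :=
    P.continuous_discount.mul (P.continuous_weight g₀ g₁)
  have hcw' : Continuous fun u => Real.exp (-P.r * u) * (-P.weight g₀ g₁ u) :=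
    P.continuous_discount.mul (P.continuous_weight g₀ g₁).neg
  have hnn1 : ∀ u : ℝ, 0 ≤ u → u ≤ S → 0 ≤ Real.exp (-P.r * u) * P.weight g₀ g₁ u *
      (P.prob 0 u - occ μ N σ 0 u) := fun u hu0 hu =>
    mul_nonneg (mul_nonneg (Real.exp_pos _).le (hw ▸ hanti.antitone hu))
      (sub_nonneg.2 (occ_le_prob hN σ zero_le_two hu0))
  have hnn2 : ∀ u : ℝ, S ≤ u → u ≤ P.T →
      0 ≤ Real.exp (-P.r * u) * (-P.weight g₀ g₁ u) * occ μ N σ 0 u := fun u hu _ =>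
    mul_nonneg (mul_nonneg (Real.exp_pos _).le (neg_nonneg.2 (hw ▸ hanti.antitone hu)))
      (occ_nonneg σ 0 u)
  have i1 := intervalIntegral.integral_nonneg (μ := volume) hS0 fun u hu => hnn1 u hu.1 hu.2
  have i2 := intervalIntegral.integral_nonneg (μ := volume) hST' fun u hu => hnn2 u hu.1 hu.2
  have i3 := integral_discount_occ_nonneg (μ := μ) (N := N) P σ 2
  have i4 := forgone_nonneg (μ := μ) (N := N) hσ
  have j3 := mul_nonneg (neg_nonneg.2 hg₂.le) i3
  have j4 := mul_nonneg hg₁.le i4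
  -- All four terms of the gap are nonnegative and their sum is not positive, so each of them
  -- vanishes.
  have z1 := ae_eq_zero_of_integral_nonpos hS0 (intervalIntegrable_lost hN hσ hcw 0 _ _) hnn1
    (by linarith)
  have z2 := ae_eq_zero_of_integral_nonpos hST' (intervalIntegrable_occ hN hσ
    hcw' 0 _ _) hnn2 (by linarith)
  have z3 := ae_eq_zero_of_integral_nonpos hT.le
    (intervalIntegrable_occ hN hσ P.continuous_discount 2 _ _)
    (fun u _ _ => mul_nonneg (Real.exp_pos _).le (occ_nonneg σ 2 u))
    (nonpos_of_mul_nonpos_right (by linarith) (neg_pos.2 hg₂))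
  have z4 : P.forgone μ N σ = 0 :=
    le_antisymm (nonpos_of_mul_nonpos_right (by linarith) hg₁) i4
  have k1 : ∀ᵐ ω ∂μ, σ ω < S → stage N (σ ω) ω ≠ 0 := by
    refine ae_stage_ne_of_stopped_null hN hσ ?_
    filter_upwards [z1] with u h hu
    have hsum := occ_add_stopped hN hσ zero_le_two hu.1.le
    have := (mul_eq_zero.1 (h hu)).resolve_left
      (mul_pos (Real.exp_pos _) (hw ▸ hanti hu.2)).ne'
    linarith
  have k2 : ∀ᵐ ω ∂μ, stage N S ω = 0 → σ ω ≤ S := by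
    refine ae_le_of_running_null hN hσ ?_
    filter_upwards [z2] with u h hu
    exact (mul_eq_zero.1 (h hu)).resolve_left
      (mul_pos (Real.exp_pos _) (neg_pos.2 (hw ▸ hanti hu.1))).ne'
  have k3 : ∀ᵐ ω ∂μ, stage N S ω = 2 → σ ω ≤ S := by
    refine ae_le_of_running_null hN hσ ?_
    filter_upwards [z3] with u h hu
    exact (mul_eq_zero.1 (h ⟨hS0.trans_lt hu.1, hu.2⟩)).resolve_left (Real.exp_pos _).ne'
  have k4 : ∀ᵐ ω ∂μ, σ ω < P.T → stage N (σ ω) ω ≠ 1 := by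
    have h := (integral_eq_zero_iff_of_nonneg (fun ω => forgone_integrand_nonneg hσ ω)
      (integrable_stopped hN hσ P.continuous_discount_mul_horizon 1)).1 z4
    filter_upwards [h] with ω hω hlt h1
    simp only [h1, if_true, mul_one, Pi.zero_apply] at hω
    exact (mul_pos (Real.exp_pos _) (P.horizon_pos (by exact_mod_cast hlt))).ne' hω
  filter_upwards [k1, k2, k3, k4] with ω h1 h2 h3 h4
  refine ⟨fun h => le_antisymm (h2 h) ?_, fun h => ?_⟩
  · by_contra hlt
    have hle := stage_mono hN ω (not_le.1 hlt).le
    simp only [h] at hle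
    exact h1 (not_le.1 hlt) (Nat.le_zero.1 hle)
  · have hle := h3 h
    have hlt := hle.trans_lt hST
    refine ⟨hlt, ?_⟩
    have h1' := h4 hlt
    -- Stage 0 is ruled out before `S` by the first term of the gap and at `S` itself because the
    -- stage there is 2.
    have h0' : stage N (σ ω) ω ≠ 0 := by
      rcases hle.lt_or_eq with h5 | h5
      · exact h1 h5
      · rw [h5, h]; norm_num
    have := stage_le_two (N := N) (σ ω) ω
    omega

/-- With an intermediate cost-benefit ratio, the optimal schedules have an interim deadline. -/
theorem optimal_of_noInterimCutoff_lt [IsProbabilityMeasure μ] (hN : IsPoissonFor P.lam μ ℱ N)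
    (hP : ¬ (P.α = 1 ∧ P.β = 0)) (h : noInterimCutoff P.T P.lam P.r P.α < P.κ)
    (h' : P.κ < fullInfoCutoff P.T P.lam P.r P.α) :
    (∃ τ, P.IsOptimal μ ℱ N τ) ∧ ∀ τ, P.IsOptimal μ ℱ N τ →
      0 < μ {ω | τ ω < P.T ∧ stage N (τ ω) ω = 2} ∧
      0 < μ {ω | 0 < τ ω ∧ τ ω < P.T ∧ stage N (τ ω) ω = 0} := by
  have hw0 := (κ_lt_fullInfoCutoff_iff P).1 h'
  have hg := P.gain_pos_of_weight_pos hw0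
  rw [← not_le, κ_le_noInterimCutoff_iff, ← integral_baseFlow, not_le] at h
  obtain ⟨S, hS0, hST, hSv, hSw⟩ := exists_interimValue_eq_zero hN hw0 h
  obtain ⟨ν, hν, hg₂, hw⟩ := P.exists_multiplier hP hg hST hSw
  obtain ⟨τ, hτ⟩ := exists_isCutoff hN 0 S
  have hg₁ : 0 < P.agentGain + ν * P.gain := add_pos (P.agentGain_pos hP) (mul_pos hν hg)
  have hnet := hτ.integral_net_eq hN hST.le
  rw [hSv] at hnet
  have hfeas := hτ.isFeasible hN hST.le hg hnet.ge
  have hL : ∀ {ρ : Ω → ℝ≥0}, P.IsSchedule ℱ ρ → P.agentPayoff μ N ρ +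
      ν * (∫ u in (0 : ℝ)..P.T, P.net μ N ρ u) = ∫ u in (0 : ℝ)..P.T, P.flow μ N ρ
        (P.β * P.c - ν * P.c) (P.agentGain + ν * P.gain)
        (P.agentDelay - ν * P.delayCost) u := by
    intro ρ hρ
    have hn : IntervalIntegrable (fun u => ν * P.net μ N ρ u) volume 0 P.T :=
      (intervalIntegrable_flow hN hρ (-P.c) P.gain (-P.delayCost) _ _).const_mul ν
    rw [agentPayoff_eq hN hρ, ← intervalIntegral.integral_const_mul,
      ← intervalIntegral.integral_add (intervalIntegrable_flow hN hρ _ _ _ _ _) hn]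
    refine intervalIntegral.integral_congr fun u _ => ?_
    simp only [net, flow]
    ring
  -- Only the date-0 constraint of `σ` is used; it binds for `τ` by the choice of `S`.
  have hgap : ∀ σ, P.IsFeasible μ ℱ N σ →
      P.lagrangianGap μ N σ S (P.β * P.c - ν * P.c) (P.agentGain + ν * P.gain)
        (P.agentDelay - ν * P.delayCost) ≤ P.agentPayoff μ N τ - P.agentPayoff μ N σ :=
    fun σ hσ => by
      have h1 := integral_flow_sub_eq_lagrangianGap hN hσ.schedule hτ hST.le (P.β * P.c - ν * P.c)
        (P.agentGain + ν * P.gain) (P.agentDelay - ν * P.delayCost)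
      rw [← hL hτ.schedule, ← hL hσ.schedule, hnet, mul_zero, add_zero] at h1
      have h2 := mul_nonneg hν.le
        ((isFeasible_iff hN hσ.schedule).1 hσ 0 le_rfl P.deadline_pos.le)
      refine h1.ge.trans ?_
      linarith
  have hanti := P.weight_strictAnti (P.β * P.c - ν * P.c) hg₁
  refine ⟨⟨τ, hfeas, fun σ hσ => ?_⟩, fun σ hσ => ?_⟩
  · have i1 := intervalIntegral.integral_nonneg (μ := volume) (NNReal.coe_nonneg S) fun u hu =>
      mul_nonneg (mul_nonneg (Real.exp_pos (-P.r * u)).le (hw ▸ hanti.antitone hu.2))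
        (sub_nonneg.2 (occ_le_prob hN σ zero_le_two hu.1))
    have i2 := intervalIntegral.integral_nonneg (μ := volume)
      (show (S : ℝ) ≤ P.T by exact_mod_cast hST.le) fun u hu =>
      mul_nonneg (mul_nonneg (Real.exp_pos (-P.r * u)).le
        (neg_nonneg.2 (hw ▸ hanti.antitone hu.1))) (occ_nonneg (μ := μ) (N := N) σ 0 u)
    have i3 := mul_nonneg (neg_nonneg.2 hg₂.le)
      (integral_discount_occ_nonneg (μ := μ) (N := N) P σ 2)
    have i4 := mul_nonneg hg₁.le (forgone_nonneg (μ := μ) (N := N) hσ.schedule)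
    have h1 := hgap σ hσ
    rw [lagrangianGap] at h1
    linarith
  · have hae := ae_of_lagrangianGap_nonpos hN hσ.feasible.schedule hST hg₁ hg₂ hw
      ((hgap σ hσ.feasible).trans (by linarith [hσ.maximal τ hfeas]))
    -- The stage at the fixed date `S` is not affected by stopping, so its law is the unstopped one.
    have hpos : ∀ i ≤ 2, 0 < P.prob i S → 0 < μ {ω | stage N S ω = i} := by
      intro i hi hp
      have hm := measureReal_stage hN hi (NNReal.coe_nonneg S)
      rw [Real.toNNReal_coe] at hm
      rw [← hm] at hp
      exact (ENNReal.toReal_pos_iff.1 hp).1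
    have hS0' : (0 : ℝ) < S := by exact_mod_cast hS0
    constructor
    · refine (hpos 2 le_rfl (P.prob_two_pos hS0')).trans_le (measure_mono_ae ?_)
      filter_upwards [hae] with ω hω h2 using hω.2 h2
    · refine (hpos 0 zero_le_two (P.prob_zero_pos S)).trans_le (measure_mono_ae ?_)
      filter_upwards [hae] with ω hω h0
      have h1 := hω.1 h0
      change 0 < σ ω ∧ σ ω < P.T ∧ stage N (σ ω) ω = 0
      rw [h1]
      exact ⟨hS0, hST, h0⟩

end IntermediateCost

end Project

theorem proposition4 :
    ∃ κtilde κFI : ℝ≥0 → ℝ≥0 → ℝ → ℝ → ℝ,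
      (∀ P : Project,
        0 < κtilde P.T P.lam P.r P.α ∧
          κtilde P.T P.lam P.r P.α < κFI P.T P.lam P.r P.α) ∧
      ∀ (P : Project) (_ : ¬ (P.α = 1 ∧ P.β = 0))
        (Ω : Type*) (m : MeasurableSpace Ω) (μ : Measure Ω) (_ : IsProbabilityMeasure μ)
        (ℱ : Filtration ℝ≥0 m) (N : ℝ≥0 → Ω → ℕ) (_ : Project.IsPoissonFor P.lam μ ℱ N),
        (P.κ < κFI P.T P.lam P.r P.α ↔ P.FullInfoProfitable μ ℱ N) ∧
        (P.κ ≤ κtilde P.T P.lam P.r P.α →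
          (∃ τ, P.IsOptimal μ ℱ N τ) ∧
          ∀ τ, P.IsOptimal μ ℱ N τ →
            ∀ᵐ ω ∂μ, min (Project.completion N ω) (P.T : WithTop ℝ≥0) ≤ (τ ω : WithTop ℝ≥0)) ∧
        (κtilde P.T P.lam P.r P.α < P.κ → P.κ < κFI P.T P.lam P.r P.α →
          (∃ τ, P.IsOptimal μ ℱ N τ) ∧
          ∀ τ, P.IsOptimal μ ℱ N τ →
            0 < μ {ω | τ ω < P.T ∧ Project.stage N (τ ω) ω = 2} ∧
            0 < μ {ω | 0 < τ ω ∧ τ ω < P.T ∧ Project.stage N (τ ω) ω = 0}) := by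
  refine ⟨Project.noInterimCutoff, Project.fullInfoCutoff, fun P => ⟨P.noInterimCutoff_pos,
    P.noInterimCutoff_lt_fullInfoCutoff⟩, fun P hP Ω m μ _ ℱ N hN => ⟨?_, ?_, ?_⟩⟩
  · rw [Project.κ_lt_fullInfoCutoff_iff, Project.fullInfoProfitable_iff hN]
    rfl
  · exact Project.optimal_of_le_noInterimCutoff hN hP
  · exact Project.optimal_of_noInterimCutoff_lt hN hP
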